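/- Let $N\in\mathbb N$ and $p\in\mathbb R$ with $1<p<N$, and put $p^*=\frac{Np}{N-p}$. Consider the lattice graph on $\mathbb Z^N$, where $x\sim y$ iff $\sum_{i=1}^N|x_i-y_i|=1$, and for $u:\mathbb Z^N\to\mathbb R$ let $\Delta_pu(x)=\sum_{y\sim x}|u(y)-u(x)|^{p-2}(u(y)-u(x))$. Let $V:\mathbb Z^N\to\mathbb R$ and $f:\mathbb Z^N\times\mathbb R\to\mathbb R$, put $F(x,t)=\int_0^tf(x,s)\,ds$, and assume: (S1) for some integer $T\ge1$, $V(x+Te_i)=V(x)$ and $f(x+Te_i,t)=f(x,t)$ for all $x\in\mathbb Z^N$, $1\le i\le N$, $t\in\mathbb R$, and $V\ge0$; (S2) $f(x,\cdot)$ is continuous for every $x$, and there are $a>0$ and $q>p^*$ with $f(x,t)\le a(1+|t|^{q-1})$ for all $x,t$; (S3) $f(x,t)=o(|t|^{p^*-1})$ as $|t|\to0$, uniformly in $x$; (S4) for every $x$, $t\mapsto f(x,t)/|t|^{p-1}$ is strictly increasing on $(-\infty,0)\cup(0,\infty)$; (S5) $F(x,t)/|t|^p\to\infty$ as $|t|\to\infty$,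 uniformly in $x$. Let $E$ be the completion of the space of finitely supported functions $u:\mathbb Z^N\to\mathbb R$ with respect to the norm $$\|u\|=\Big(\sum_{x\sim y}\tfrac12|u(y)-u(x)|^p+\sum_{x}V(x)|u(x)|^p\Big)^{1/p}$$ (the first sum being over ordered pairs), realized as a space of functions on $\mathbb Z^N$ by taking pointwise limits of Cauchy sequences. For $u,v\in E$ let $\Phi(u)=\frac1p\|u\|^p-\sum_xF(x,u(x))$ and $$\langle\Phi'(u),v\rangle=\sum_{x\sim y}\tfrac12|u(y)-u(x)|^{p-2}(u(y)-u(x))(v(y)-v(x))+\sum_xV(x)|u(x)|^{p-2}u(x)v(x)-\sum_xf(x,u(x))v(x),$$ and let $\mathcal N=\{u\in E\setminus\{0\}:\langle\Phi'(u),u\rangle=0\}$. A ground state is a $u\in\mathcal N$ with $\Phi(u)=\inf_{\mathcal N}\Phi$. Then a ground state exists, and every ground state $u$ is a solution of $$-\Delta_pu(x)+V(x)|u(x)|^{p-2}u(x)=f(x,u(x)),\qquad x\in\mathbb Z^N,\quad u\in E.$$ Moreover, if $F(x,t)\le F(x,|t|)$ for all $(x,t)\in\mathbb Z^N\times\mathbb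 R$, then every ground state $u$ satisfies either $u(x)>0$ for all $x$ or $u(x)<0$ for all $x$. -/

import Mathlib

open Filter Topology

namespace LatticePLaplace

/-- The integer lattice graph on `ℤ^N`: `x ∼ y` iff `∑ |x i - y i| = 1`. -/
def lattice (N : ℕ) : SimpleGraph (Fin N → ℤ) where
  Adj x y := ∑ i, |x i - y i| = 1
  symm := ⟨fun x y h => by simpa only [abs_sub_comm] using h⟩
  loopless := ⟨fun x h => by simp at h⟩

/-- `h` is `T`-periodic: `h (x + T e_i) = h x` for all `x` and all `i`. -/
def IsPeriodic {N : ℕ} {β : Type*} (T : ℕ) (h : (Fin N → ℤ) → β) : Prop :=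
  ∀ (x : Fin N → ℤ) (i : Fin N), h (x + Pi.single i (T : ℤ)) = h x

noncomputable section

/-- The critical exponent `p^* = N p / (N - p)`. -/
def pStar (N : ℕ) (p : ℝ) : ℝ := N * p / (N - p)

/-- The discrete `p`-Laplacian
`Δ_p u (x) = ∑_{y ∼ x} |u y - u x|^(p-2) (u y - u x)`.
Each vertex has finitely many neighbours, so the sum is finite. -/
def pLaplacian {N : ℕ} (p : ℝ) (u : (Fin N → ℤ) → ℝ) (x : Fin N → ℤ) : ℝ :=
  ∑' y : (lattice N).neighborSet x, |u y - u x| ^ (p - 2) * (u y - u x)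

/-- `∑_{x ∼ y} (1/2) |u y - u x|^p + ∑_x V x |u x|^p`. The first sum runs over ordered pairs of
adjacent vertices, which are the darts of the graph. -/
def normPow {N : ℕ} (p : ℝ) (V : (Fin N → ℤ) → ℝ) (u : (Fin N → ℤ) → ℝ) : ℝ :=
  (∑' d : (lattice N).Dart, (1 / 2) * |u d.snd - u d.fst| ^ p) + ∑' x, V x * |u x| ^ p

/-- The norm `‖u‖`. -/
def eNorm {N : ℕ} (p : ℝ) (V : (Fin N → ℤ) → ℝ) (u : (Fin N → ℤ) → ℝ) : ℝ :=
  normPow p V u ^ (1 / p)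

/-- The space `E`, the completion of the finitely supported functions `C_c(ℤ^N)` with respect to
`‖·‖`, realized as a space of functions: its elements are the pointwise limits of `‖·‖`-Cauchy
sequences in `C_c(ℤ^N)`. For `1 ≤ p < N` and `V ≥ 0` every Cauchy sequence converges pointwise
(Sobolev inequality), and two Cauchy sequences have the same pointwise limit if and only if their
difference tends to `0` in norm, so this is the completion. -/
def E {N : ℕ} (p : ℝ) (V : (Fin N → ℤ) → ℝ) : Set ((Fin N → ℤ) → ℝ) :=
  {u | ∃ w : ℕ → (Fin N → ℤ) → ℝ,
    (∀ n, (Function.support (w n)).Finite) ∧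
    (∀ ε > 0, ∃ n₀, ∀ m ≥ n₀, ∀ n ≥ n₀, eNorm p V (w m - w n) < ε) ∧
    ∀ x, Tendsto (fun n => w n x) atTop (𝓝 (u x))}

/-- The primitive `F (x, t) = ∫_0^t f (x, s) ds`. -/
def primitive {N : ℕ} (f : (Fin N → ℤ) → ℝ → ℝ) (x : Fin N → ℤ) (t : ℝ) : ℝ :=
  ∫ s in (0 : ℝ)..t, f x s

/-- The energy functional `Φ(u) = (1/p) ‖u‖^p - ∑_x F (x, u x)`. -/
def energy {N : ℕ} (p : ℝ) (V : (Fin N → ℤ) → ℝ) (f : (Fin N → ℤ) → ℝ → ℝ)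
    (u : (Fin N → ℤ) → ℝ) : ℝ :=
  (1 / p) * normPow p V u - ∑' x, primitive f x (u x)

/-- The derivative pairing `⟨Φ'(u), v⟩`. -/
def energyDeriv {N : ℕ} (p : ℝ) (V : (Fin N → ℤ) → ℝ) (f : (Fin N → ℤ) → ℝ → ℝ)
    (u v : (Fin N → ℤ) → ℝ) : ℝ :=
  (∑' d : (lattice N).Dart, (1 / 2) *
      (|u d.snd - u d.fst| ^ (p - 2) * (u d.snd - u d.fst) * (v d.snd - v d.fst)))
    + (∑' x, V x * |u x| ^ (p - 2) * u x * v x) - ∑' x, f x (u x) * v x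

/-- The Nehari manifold `{u ∈ E \ {0} : ⟨Φ'(u), u⟩ = 0}`. -/
def nehari {N : ℕ} (p : ℝ) (V : (Fin N → ℤ) → ℝ) (f : (Fin N → ℤ) → ℝ → ℝ) :
    Set ((Fin N → ℤ) → ℝ) :=
  {u | u ∈ E p V ∧ u ≠ 0 ∧ energyDeriv p V f u u = 0}

/-- A ground state: an element of the Nehari manifold at which `Φ` attains its infimum over the
Nehari manifold. -/
def IsGroundState {N : ℕ} (p : ℝ) (V : (Fin N → ℤ) → ℝ) (f : (Fin N → ℤ) → ℝ → ℝ)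
    (u : (Fin N → ℤ) → ℝ) : Prop :=
  u ∈ nehari p V f ∧ ∀ v ∈ nehari p V f, energy p V f u ≤ energy p V f v

/-- `u` solves `-Δ_p u + V |u|^(p-2) u = f (x, u)`, `u ∈ E`. -/
def IsSolution {N : ℕ} (p : ℝ) (V : (Fin N → ℤ) → ℝ) (f : (Fin N → ℤ) → ℝ → ℝ)
    (u : (Fin N → ℤ) → ℝ) : Prop :=
  u ∈ E p V ∧ ∀ x, -pLaplacian p u x + V x * |u x| ^ (p - 2) * u x = f x (u x)

end

end LatticePLaplace

/-!
Under (S3)–(S5) every ray `{t • u : t > 0}` meets the Nehari manifold exactly once, at the maximum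
of the energy along the ray. A minimizing sequence on the Nehari manifold is bounded, and it cannot
vanish uniformly: by the Sobolev inequality and (S3), `∑ f (x, u x) u x` would then be small
compared with `‖u‖ ^ p`. Translating by multiples of the period gives a nonzero pointwise limit. By
the Brezis–Lieb splitting of the norm and of the nonlinear terms, the Nehari functional is
nonpositive at this limit, and the point where its ray meets the Nehari manifold is a minimizer.

The Nehari manifold need not be smooth. A ground state `u` is a solution because, if
`⟨Φ'(u), v⟩ < 0` for some finitely supported `v`, then `Φ (t • u + s • v) < Φ (t • u) ≤ Φ u` for `t`
near `1` and small `s > 0`, while for fixed `s` the Nehari functional still changes sign as `t`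
crosses `1`. If `F (x, t) ≤ F (x, |t|)`, passing from `u` to `|u|` does not increase the energy, and
decreases it strictly when `u` changes sign across an edge.
-/

namespace LatticePLaplace

section RealPowers

lemma abs_rpow_sub_rpow_le {r : ℝ} (hr : 1 ≤ r) {a b : ℝ} (ha : 0 ≤ a) (hb : 0 ≤ b) :
    |a ^ r - b ^ r| ≤ r * (a ^ (r - 1) + b ^ (r - 1)) * |a - b| := by
  wlog hab : b ≤ a generalizing a b
  · have := this hb ha (le_of_not_ge hab)
    rwa [abs_sub_comm, abs_sub_comm a b, add_comm (a ^ (r - 1))]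
  rw [abs_of_nonneg (sub_nonneg.2 (Real.rpow_le_rpow hb hab (by linarith))),
    abs_of_nonneg (sub_nonneg.2 hab)]
  rcases hab.eq_or_lt with rfl | hlt
  · simp
  obtain ⟨c, hc, hslope⟩ := exists_hasDerivAt_eq_slope (fun t : ℝ => t ^ r)
    (fun t => r * t ^ (r - 1)) hlt (Real.continuous_rpow_const (by linarith)).continuousOn
    (fun t _ => Real.hasDerivAt_rpow_const (Or.inr hr))
  rw [eq_div_iff (by linarith)] at hslope
  rw [← hslope]
  gcongr
  calc c ^ (r - 1) ≤ a ^ (r - 1) := Real.rpow_le_rpow (hb.trans hc.1.le) hc.2.le (by linarith)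
    _ ≤ a ^ (r - 1) + b ^ (r - 1) := le_add_of_nonneg_right (by positivity)

lemma abs_add_rpow_le {p : ℝ} (hp : 0 ≤ p) (a b : ℝ) :
    |a + b| ^ p ≤ 2 ^ p * (|a| ^ p + |b| ^ p) := by
  have hmax : |a + b| ≤ 2 * max |a| |b| := by
    linarith [abs_add_le a b, le_max_left |a| |b|, le_max_right |a| |b|]
  calc |a + b| ^ p ≤ (2 * max |a| |b|) ^ p := Real.rpow_le_rpow (abs_nonneg _) hmax hp
    _ = 2 ^ p * max |a| |b| ^ p := Real.mul_rpow (by norm_num) (by positivity)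
    _ ≤ 2 ^ p * (|a| ^ p + |b| ^ p) := by
      gcongr
      rcases max_choice |a| |b| with h | h <;> rw [h]
      · exact le_add_of_nonneg_right (by positivity)
      · exact le_add_of_nonneg_left (by positivity)

lemma le_mul_rpow_of_rpow_le {S A D α β s t : ℝ} (hS : 0 ≤ S) (hA : 0 ≤ A) (hD : 0 ≤ D)
    (hs : 0 < s) (hαβ : α = s⁻¹ + β) (h : S ^ α ≤ A * (S ^ β * D ^ t)) :
    S ≤ A ^ s * D ^ (t * s) := by
  rcases hS.eq_or_lt with rfl | hS0
  · positivity
  have hroot : S ^ s⁻¹ ≤ A * D ^ t := by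
    rw [hαβ, Real.rpow_add hS0] at h
    exact le_of_mul_le_mul_right (h.trans_eq (by ring)) (Real.rpow_pos_of_pos hS0 β)
  calc S = (S ^ s⁻¹) ^ s := (Real.rpow_inv_rpow hS hs.ne').symm
    _ ≤ (A * D ^ t) ^ s := Real.rpow_le_rpow (by positivity) hroot hs.le
    _ = A ^ s * D ^ (t * s) := by
      rw [Real.mul_rpow hA (by positivity), ← Real.rpow_mul hD]

lemma abs_rpow_sub_two_mul_mul {p : ℝ} (hp : p ≠ 0) (a : ℝ) : |a| ^ (p - 2) * a * a = |a| ^ p := by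
  rcases eq_or_ne a 0 with rfl | ha
  · simp [Real.zero_rpow hp]
  · rw [mul_assoc, ← abs_mul_abs_self, ← pow_two, ← Real.rpow_natCast |a| 2,
      ← Real.rpow_add (abs_pos.2 ha)]
    norm_num

end RealPowers

section Series

variable {X : Type*}

lemma summable_comp_of_finite_support {u : X → ℝ} (hu : (Function.support u).Finite) {h : X → ℝ → ℝ}
    (h0 : ∀ x, h x 0 = 0) : Summable fun x => h x (u x) :=
  summable_of_hasFiniteSupport <| hu.subset fun x hx hux => hx (by simp only [hux, h0])

lemma tendsto_cofinite_of_summable_rpow {r : ℝ} (hr : 0 < r) {u : X → ℝ}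
    (hu : Summable fun x => |u x| ^ r) : Tendsto u cofinite (𝓝 0) := by
  have h := hu.tendsto_cofinite_zero.rpow_const (p := r⁻¹) (Or.inr (by positivity))
  rw [Real.zero_rpow (by positivity)] at h
  exact squeeze_zero_norm (fun x => (Real.rpow_rpow_inv (abs_nonneg _) hr.ne').ge) h

lemma summable_and_tsum_le_of_tendsto {g : ℕ → X → ℝ} {h : X → ℝ} {C : ℝ}
    (hg : ∀ n x, 0 ≤ g n x) (hs : ∀ n, Summable (g n)) (hC : ∀ᶠ n in atTop, ∑' x, g n x ≤ C)
    (ht : ∀ x, Tendsto (fun n => g n x) atTop (𝓝 (h x))) :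
    Summable h ∧ ∑' x, h x ≤ C := by
  have h0 : 0 ≤ h := fun x => ge_of_tendsto' (ht x) fun n => hg n x
  have hfin : ∀ s : Finset X, ∑ x ∈ s, h x ≤ C := fun s =>
    le_of_tendsto (tendsto_finsetSum s fun x _ => ht x) <| hC.mono fun n hn =>
      ((hs n).sum_le_tsum s fun x _ => hg n x).trans hn
  have hsum := summable_of_sum_le h0 hfin
  exact ⟨hsum, hsum.tsum_le_of_sum_le hfin⟩

/-- Hölder's inequality for the increments of `|u| ^ γ` along `e`, written with
`| |b| ^ γ - |a| ^ γ | ≤ γ (|b| ^ (γ - 1) + |a| ^ (γ - 1)) |b - a|`. -/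
lemma tsum_abs_rpow_comp_sub_le {γ p q : ℝ} (e : X ≃ X) (hγ : 1 ≤ γ) (hqp : q.HolderConjugate p)
    {u : X → ℝ} (hu : Summable fun x => |u x| ^ ((γ - 1) * q))
    (hdu : Summable fun x => |u (e x) - u x| ^ p) :
    ∑' x, |(|u (e x)| ^ γ) - |u x| ^ γ| ≤ 2 * γ *
      ((∑' x, |u x| ^ ((γ - 1) * q)) ^ (1 / q) * (∑' x, |u (e x) - u x| ^ p) ^ (1 / p)) := by
  have hpow : ∀ a : ℝ, (|a| ^ (γ - 1)) ^ q = |a| ^ ((γ - 1) * q) := fun a =>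
    (Real.rpow_mul (abs_nonneg a) _ _).symm
  obtain ⟨hs₁, hle₁⟩ := Real.summable_and_inner_le_Lp_mul_Lq_tsum_of_nonneg hqp
    (f := fun x => |u (e x)| ^ (γ - 1)) (g := fun x => |u (e x) - u x|)
    (fun _ => by positivity) (fun _ => by positivity)
    (by simp only [hpow]; exact hu.comp_injective e.injective) hdu
  obtain ⟨hs₂, hle₂⟩ := Real.summable_and_inner_le_Lp_mul_Lq_tsum_of_nonneg hqp
    (f := fun x => |u x| ^ (γ - 1)) (g := fun x => |u (e x) - u x|)
    (fun _ => by positivity) (fun _ => by positivity) (by simpa only [hpow] using hu) hdu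
  simp only [hpow, e.tsum_eq fun x => |u x| ^ ((γ - 1) * q)] at hle₁ hle₂
  have hpt : ∀ x, |(|u (e x)| ^ γ) - |u x| ^ γ| ≤
      γ * (|u (e x)| ^ (γ - 1) * |u (e x) - u x| + |u x| ^ (γ - 1) * |u (e x) - u x|) := fun x => by
    refine (abs_rpow_sub_rpow_le hγ (abs_nonneg _) (abs_nonneg _)).trans ?_
    rw [← add_mul, mul_assoc]
    gcongr _ * (_ * ?_)
    exact abs_abs_sub_abs_le _ _
  have hs := (hs₁.add hs₂).mul_left γ
  set A := (∑' x, |u x| ^ ((γ - 1) * q)) ^ (1 / q) * (∑' x, |u (e x) - u x| ^ p) ^ (1 / p)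
  calc ∑' x, |(|u (e x)| ^ γ) - |u x| ^ γ|
      ≤ ∑' x, γ * (|u (e x)| ^ (γ - 1) * |u (e x) - u x| + |u x| ^ (γ - 1) * |u (e x) - u x|) :=
        Summable.tsum_le_tsum hpt (.of_nonneg_of_le (fun _ => abs_nonneg _) hpt hs) hs
    _ = γ * ((∑' x, |u (e x)| ^ (γ - 1) * |u (e x) - u x|) +
          ∑' x, |u x| ^ (γ - 1) * |u (e x) - u x|) := by rw [tsum_mul_left, hs₁.tsum_add hs₂]
    _ ≤ γ * (A + A) :=
        mul_le_mul_of_nonneg_left (add_le_add hle₁ hle₂) (zero_le_one.trans hγ)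
    _ = 2 * γ * A := by ring

end Series

section Lattice

variable {N : ℕ}

/-- The dart from `x` to `x + e_i`. -/
def coordDart (i : Fin N) (x : Fin N → ℤ) : (lattice N).Dart :=
  ⟨(x, x + Pi.single i 1), by
    change ∑ j, |x j - (x + Pi.single i 1 : Fin N → ℤ) j| = 1
    rw [Finset.sum_eq_single i] <;> simp +contextual⟩

lemma coordDart_injective (i : Fin N) : Function.Injective (coordDart i) := fun _ _ h =>
  congrArg (fun d : (lattice N).Dart => d.fst) h

lemma neighborSet_finite (x : Fin N → ℤ) : ((lattice N).neighborSet x).Finite := by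
  refine (Set.finite_Icc (x - 1) (x + 1)).subset fun y (hy : ∑ i, |x i - y i| = 1) => ?_
  have h : ∀ i, |x i - y i| ≤ 1 := fun i => hy ▸
    Finset.single_le_sum (f := fun i => |x i - y i|) (fun _ _ => abs_nonneg _) (Finset.mem_univ i)
  constructor <;> intro i <;> have := abs_le.1 (h i) <;>
    simp only [Pi.sub_apply, Pi.add_apply, Pi.one_apply] <;> lia

lemma finite_setOf_fst_mem {s : Set (Fin N → ℤ)} (hs : s.Finite) :
    {d : (lattice N).Dart | d.fst ∈ s}.Finite := by
  have h : (⋃ x ∈ s, (fun y => (x, y)) '' (lattice N).neighborSet x).Finite :=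
    hs.biUnion fun x _ => (neighborSet_finite x).image _
  refine (h.preimage (SimpleGraph.Dart.toProd_injective (G := lattice N)).injOn).subset ?_
  intro d hd
  simp only [Set.mem_preimage, Set.mem_iUnion]
  exact ⟨d.fst, hd, d.snd, d.adj, rfl⟩

lemma finite_setOf_snd_mem {s : Set (Fin N → ℤ)} (hs : s.Finite) :
    {d : (lattice N).Dart | d.snd ∈ s}.Finite :=
  Set.Finite.preimage (f := SimpleGraph.Dart.symm)
    SimpleGraph.Dart.symm_involutive.injective.injOn (finite_setOf_fst_mem hs)

/-- Translation of darts by `z`. -/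
def dartShift (z : Fin N → ℤ) : (lattice N).Dart ≃ (lattice N).Dart where
  toFun d := ⟨(d.fst + z, d.snd + z), by
    have : ∑ i, |d.fst i - d.snd i| = 1 := d.adj
    change ∑ i, |(d.fst + z) i - (d.snd + z) i| = 1
    simpa using this⟩
  invFun d := ⟨(d.fst - z, d.snd - z), by
    have : ∑ i, |d.fst i - d.snd i| = 1 := d.adj
    change ∑ i, |(d.fst - z) i - (d.snd - z) i| = 1
    simpa using this⟩
  left_inv d := by ext <;> simp
  right_inv d := by ext <;> simp

end Lattice

section Sobolev

variable {N : ℕ} {p : ℝ}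

lemma lt_pStar (hp : 0 < p) (hpN : p < N) : p < pStar N p := by
  rw [pStar, lt_div_iff₀ (sub_pos.2 hpN)]
  nlinarith

lemma pStar_pos (hp : 0 < p) (hpN : p < N) : 0 < pStar N p := hp.trans (lt_pStar hp hpN)

open MeasureTheory in
lemma enorm_le_tsum_enorm_sub (g : ℤ → ℝ) (hg : (Function.support g).Finite) (k : ℤ) :
    ‖g k‖ₑ ≤ ∑' t : ℤ, ‖g (t + 1) - g t‖ₑ := by
  have htelescope : ∀ n : ℕ, ‖g k‖ₑ ≤
      (∑ j ∈ Finset.range n, ‖g (k + j + 1) - g (k + j)‖ₑ) + ‖g (k + n)‖ₑ := fun n => by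
    induction n with
    | zero => simp
    | succ n ih =>
      rw [Finset.sum_range_succ, add_assoc]
      refine ih.trans ?_
      gcongr
      calc ‖g (k + n)‖ₑ = ‖-(g (k + n + 1) - g (k + n)) + g (k + n + 1)‖ₑ := by ring_nf
        _ ≤ ‖-(g (k + n + 1) - g (k + n))‖ₑ + ‖g (k + n + 1)‖ₑ := enorm_add_le _ _
        _ = ‖g (k + n + 1) - g (k + n)‖ₑ + ‖g (k + (n + 1 : ℕ))‖ₑ := by
          rw [enorm_neg, Nat.cast_succ, add_assoc k]
  obtain ⟨n, hn⟩ : ∃ n : ℕ, g (k + n) = 0 := by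
    obtain ⟨B, hB⟩ := hg.bddAbove
    refine ⟨(B - k).toNat + 1, by_contra fun h => ?_⟩
    have := hB h
    have := Int.self_le_toNat (B - k)
    lia
  calc ‖g k‖ₑ ≤ ∑ j ∈ Finset.range n, ‖g (k + j + 1) - g (k + j)‖ₑ := by
        simpa [hn] using htelescope n
    _ ≤ ∑' j : ℕ, ‖g (k + j + 1) - g (k + j)‖ₑ := ENNReal.sum_le_tsum _
    _ ≤ ∑' t : ℤ, ‖g (t + 1) - g t‖ₑ :=
        ENNReal.tsum_comp_le_tsum_of_injective (f := fun j : ℕ => k + (j : ℤ))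
          (fun a b h => by simpa using h) (fun t => ‖g (t + 1) - g t‖ₑ)

open MeasureTheory in
lemma pi_count_eq_count (ι : Type*) [Fintype ι] :
    Measure.pi (fun _ : ι => (Measure.count : Measure ℤ)) = Measure.count := by
  refine Measure.ext_of_singleton fun x => ?_
  rw [Measure.count_singleton, Measure.pi_singleton]
  simp

open MeasureTheory in
/-- The discrete Gagliardo–Nirenberg inequality: every factor of
`|v x| ^ (N / (N - 1)) = ∏ i, |v x| ^ (1 / (N - 1))` is bounded by the variation of `v` on the line
through `x` in direction `i`, and Mathlib's grid-line inequality sums the product. -/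
lemma tsum_enorm_rpow_le (hN : 2 ≤ N) (v : (Fin N → ℤ) → ℝ) (hv : (Function.support v).Finite) :
    ∑' x, ‖v x‖ₑ ^ ((N : ℝ) / (N - 1)) ≤
      (∑' x, ∑ i, ‖v (x + Pi.single i 1) - v x‖ₑ) ^ ((N : ℝ) / (N - 1)) := by
  have hN' : (1 : ℝ) < N := by exact_mod_cast hN
  have hconj : Real.HolderConjugate (Fintype.card (Fin N) : ℝ) ((N : ℝ) / (N - 1)) := by
    rw [Fintype.card_fin]
    exact Real.HolderConjugate.conjExponent hN'
  have hgrid := lintegral_prod_lintegral_pow_le (ι := Fin N) (A := fun _ => ℤ)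
    (fun _ => (Measure.count : Measure ℤ)) hconj
    (f := fun x => ∑ i, ‖v (x + Pi.single i 1) - v x‖ₑ) (measurable_of_countable _)
  rw [pi_count_eq_count, lintegral_count, lintegral_count] at hgrid
  have hline : ∀ x (i : Fin N), ‖v x‖ₑ ≤
      ∫⁻ t, ∑ j, ‖v (Function.update x i t + Pi.single j 1) - v (Function.update x i t)‖ₑ
        ∂(Measure.count : Measure ℤ) := fun x i => by
    rw [lintegral_count]
    have hvar := enorm_le_tsum_enorm_sub (fun t => v (Function.update x i t))
      (hv.preimage (Function.update_injective x i).injOn) (x i)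
    simp only [Function.update_eq_self] at hvar
    refine hvar.trans (ENNReal.tsum_le_tsum fun t => ?_)
    have hupd : Function.update x i (t + 1) = Function.update x i t + Pi.single i 1 := by
      ext j
      rcases eq_or_ne j i with rfl | hj
      · simp
      · simp [hj]
    rw [hupd]
    exact Finset.single_le_sum
      (f := fun j => ‖v (Function.update x i t + Pi.single j 1) - v (Function.update x i t)‖ₑ)
      (fun _ _ => zero_le) (Finset.mem_univ i)
  refine (ENNReal.tsum_le_tsum fun x => ?_).trans hgrid
  calc ‖v x‖ₑ ^ ((N : ℝ) / (N - 1)) = ∏ _i : Fin N, ‖v x‖ₑ ^ ((1 : ℝ) / (N - 1)) := by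
        rw [Finset.prod_const, Finset.card_univ, Fintype.card_fin, ← ENNReal.rpow_natCast,
          ← ENNReal.rpow_mul]
        congr 1
        ring
    _ ≤ _ := by
        refine Finset.prod_le_prod' fun i _ => ?_
        rw [Fintype.card_fin]
        exact ENNReal.rpow_le_rpow (hline x i) (one_div_nonneg.2 (by linarith))

lemma tsum_abs_rpow_le (hN : 2 ≤ N) (v : (Fin N → ℤ) → ℝ) (hv : (Function.support v).Finite) :
    ∑' x, |v x| ^ ((N : ℝ) / (N - 1)) ≤
      (∑ i, ∑' x, |v (x + Pi.single i 1) - v x|) ^ ((N : ℝ) / (N - 1)) := by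
  have hN' : (1 : ℝ) < N := by exact_mod_cast hN
  have hr : (0 : ℝ) < (N : ℝ) / (N - 1) := div_pos (by linarith) (by linarith)
  have hsum : Summable v := summable_of_hasFiniteSupport hv
  have hdiff : ∀ i : Fin N, Summable fun x => |v (x + Pi.single i 1) - v x| := fun i =>
    ((hsum.comp_injective (add_left_injective (Pi.single i 1))).sub hsum).abs
  have hpow : Summable fun x => |v x| ^ ((N : ℝ) / (N - 1)) :=
    summable_comp_of_finite_support hv (h := fun _ t => |t| ^ ((N : ℝ) / (N - 1)))
      fun _ => by simp [Real.zero_rpow hr.ne']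
  have hlhs : ∑' x, ‖v x‖ₑ ^ ((N : ℝ) / (N - 1)) =
      ENNReal.ofReal (∑' x, |v x| ^ ((N : ℝ) / (N - 1))) := by
    rw [ENNReal.ofReal_tsum_of_nonneg (fun _ => by positivity) hpow]
    congr with x
    rw [Real.enorm_eq_ofReal_abs, ENNReal.ofReal_rpow_of_nonneg (abs_nonneg _) hr.le]
  have hrhs : ∑' x, ∑ i, ‖v (x + Pi.single i 1) - v x‖ₑ =
      ENNReal.ofReal (∑ i, ∑' x, |v (x + Pi.single i 1) - v x|) := by
    rw [← Summable.tsum_finsetSum fun i _ => hdiff i,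
      ENNReal.ofReal_tsum_of_nonneg (fun _ => by positivity) (summable_sum fun i _ => hdiff i)]
    congr with x
    rw [ENNReal.ofReal_sum_of_nonneg fun _ _ => abs_nonneg _]
    simp only [Real.enorm_eq_ofReal_abs]
  have hnonneg : 0 ≤ ∑ i, ∑' x, |v (x + Pi.single i 1) - v x| :=
    Finset.sum_nonneg fun i _ => tsum_nonneg fun _ => abs_nonneg _
  have h := tsum_enorm_rpow_le hN v hv
  rwa [hlhs, hrhs, ENNReal.ofReal_rpow_of_nonneg hnonneg hr.le,
    ENNReal.ofReal_le_ofReal_iff (by positivity)] at h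

lemma sum_tsum_abs_rpow_sub_le {γ q : ℝ} (hγ : 1 ≤ γ) (hqp : q.HolderConjugate p)
    {u : (Fin N → ℤ) → ℝ} (hu : Summable fun x => |u x| ^ ((γ - 1) * q))
    (hdu : Summable fun d : (lattice N).Dart => |u d.snd - u d.fst| ^ p) :
    ∑ i, ∑' x, |(|u (x + Pi.single i 1)| ^ γ) - |u x| ^ γ| ≤
      N * (2 * γ * ((∑' x, |u x| ^ ((γ - 1) * q)) ^ (1 / q) *
        (∑' d : (lattice N).Dart, |u d.snd - u d.fst| ^ p) ^ (1 / p))) := by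
  have hdir : ∀ i : Fin N, ∑' x, |(|u (x + Pi.single i 1)| ^ γ) - |u x| ^ γ| ≤
      2 * γ * ((∑' x, |u x| ^ ((γ - 1) * q)) ^ (1 / q) *
        (∑' d : (lattice N).Dart, |u d.snd - u d.fst| ^ p) ^ (1 / p)) := fun i => by
    have hdi : Summable fun x => |u (x + Pi.single i 1) - u x| ^ p :=
      (hdu.comp_injective (coordDart_injective i) :)
    have hle : ∑' x, |u (x + Pi.single i 1) - u x| ^ p ≤
        ∑' d : (lattice N).Dart, |u d.snd - u d.fst| ^ p :=
      (tsum_comp_le_tsum_of_inj hdu (fun _ => by positivity) (coordDart_injective i) :)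
    refine (tsum_abs_rpow_comp_sub_le (Equiv.addRight (Pi.single i 1)) hγ hqp hu hdi).trans ?_
    have hp := hqp.symm.pos
    refine mul_le_mul_of_nonneg_left (mul_le_mul_of_nonneg_left (Real.rpow_le_rpow
      (tsum_nonneg fun _ => ?_) hle ?_) (Real.rpow_nonneg (tsum_nonneg fun _ => ?_) _)) ?_ <;>
    positivity
  refine (Finset.sum_le_sum fun i _ => hdir i).trans_eq ?_
  rw [Finset.sum_const, Finset.card_univ, Fintype.card_fin, nsmul_eq_mul]

lemma tsum_abs_rpow_pStar_rpow_le (hp : 1 < p) (hpN : p < N) {u : (Fin N → ℤ) → ℝ}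
    (hu : (Function.support u).Finite)
    (hdu : Summable fun d : (lattice N).Dart => |u d.snd - u d.fst| ^ p) :
    (∑' x, |u x| ^ pStar N p) ^ ((N - 1 : ℝ) / N) ≤
      N * (2 * (p * (N - 1) / (N - p))) * ((∑' x, |u x| ^ pStar N p) ^ ((p - 1) / p) *
        (∑' d : (lattice N).Dart, |u d.snd - u d.fst| ^ p) ^ (1 / p)) := by
  have hN : 2 ≤ N := by exact_mod_cast hp.trans hpN
  have hN0 : (0 : ℝ) < N - 1 := by linarith
  have hNp : 0 < (N : ℝ) - p := by linarith
  have hp1 : 0 < p - 1 := by linarith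
  generalize hγ : p * ((N : ℝ) - 1) / (N - p) = γ
  have hγ1 : 1 ≤ γ := by rw [← hγ, le_div_iff₀ hNp]; nlinarith
  have hγq : (γ - 1) * (p / (p - 1)) = pStar N p := by rw [← hγ, pStar]; field_simp; ring
  have hγN : γ * ((N : ℝ) / (N - 1)) = pStar N p := by rw [← hγ, pStar]; field_simp
  have hGN := tsum_abs_rpow_le hN (fun x => |u x| ^ γ) <|
    hu.subset fun x hx hux => hx (by simp [hux, Real.zero_rpow (by linarith : γ ≠ 0)])
  have hincr := sum_tsum_abs_rpow_sub_le hγ1 (Real.HolderConjugate.conjExponent hp).symm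
    (summable_comp_of_finite_support hu (h := fun _ t => |t| ^ ((γ - 1) * (p / (p - 1))))
      fun _ => by simp [hγq, (pStar_pos (by linarith) hpN).ne']) hdu
  simp only [abs_of_nonneg (Real.rpow_nonneg (abs_nonneg _) γ), ← Real.rpow_mul (abs_nonneg _),
    hγN] at hGN
  rw [Real.conjExponent, hγq, one_div_div, ← mul_assoc] at hincr
  rw [← inv_div, Real.rpow_inv_le_iff_of_pos (tsum_nonneg fun _ => by positivity)
    (mul_nonneg (by positivity) (mul_nonneg
      (Real.rpow_nonneg (tsum_nonneg fun _ => by positivity) _)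
      (Real.rpow_nonneg (tsum_nonneg fun _ => by positivity) _))) (by positivity)]
  exact hGN.trans (Real.rpow_le_rpow
    (Finset.sum_nonneg fun i _ => tsum_nonneg fun _ => abs_nonneg _) hincr (by positivity))

/-- The discrete Sobolev inequality, by the Gagliardo–Nirenberg inequality for
`|u| ^ (p (N - 1) / (N - p))`. -/
theorem exists_tsum_abs_rpow_pStar_le (hp : 1 < p) (hpN : p < N) :
    ∃ K > 0, ∀ u : (Fin N → ℤ) → ℝ, (Function.support u).Finite →
      (Summable fun d : (lattice N).Dart => |u d.snd - u d.fst| ^ p) →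
      ∑' x, |u x| ^ pStar N p ≤
        K * (∑' d : (lattice N).Dart, |u d.snd - u d.fst| ^ p) ^ (pStar N p / p) := by
  have hN0 : (0 : ℝ) < N - 1 := by linarith
  have : 0 < (N : ℝ) - p := by linarith
  have hN : (0 : ℝ) < N := by linarith
  have hexp : (N - 1 : ℝ) / N = (pStar N p)⁻¹ + (p - 1) / p := by
    rw [pStar]
    field_simp
    ring
  refine ⟨(N * (2 * (p * (N - 1) / (N - p)))) ^ pStar N p, by positivity, fun u hu hdu => ?_⟩
  simpa only [one_div_mul_eq_div] using le_mul_rpow_of_rpow_le (tsum_nonneg fun _ => by positivity)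
    (by positivity) (tsum_nonneg fun _ => by positivity) (pStar_pos (by linarith) hpN) hexp
    (tsum_abs_rpow_pStar_rpow_le hp hpN hu hdu)

end Sobolev

section FiniteEnergy

variable {N : ℕ} {p : ℝ} {V u w : (Fin N → ℤ) → ℝ}

/-- The index set of the series defining `‖u‖ ^ p`: a dart stands for the difference of `u` along
it, a vertex for the value of `u` there. -/
abbrev Cell (N : ℕ) : Type := (lattice N).Dart ⊕ (Fin N → ℤ)

/-- The coefficient with which a cell enters `‖u‖ ^ p`. -/
noncomputable def weight (V : (Fin N → ℤ) → ℝ) : Cell N → ℝ := Sum.elim (fun _ => 1 / 2) V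

/-- The gradient of `u` on the darts, extended by the values of `u` on the vertices. -/
def grad : ((Fin N → ℤ) → ℝ) →ₗ[ℝ] Cell N → ℝ where
  toFun u := Sum.elim (fun d => u d.snd - u d.fst) u
  map_add' u v := by ext (d | x) <;> simp [add_sub_add_comm]
  map_smul' a u := by ext (d | x) <;> simp [mul_sub]

/-- The contribution of a cell to `‖u‖ ^ p`. -/
noncomputable def density (p : ℝ) (V u : (Fin N → ℤ) → ℝ) (c : Cell N) : ℝ :=
  weight V c * |grad u c| ^ p

/-- An intrinsic description of the elements of `E`: the functions that vanish at infinity and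
have finite norm. -/
structure HasFiniteEnergy (p : ℝ) (V u : (Fin N → ℤ) → ℝ) : Prop where
  tendsto_zero : Tendsto u cofinite (𝓝 0)
  summable_density : Summable (density p V u)

@[simp] lemma grad_inl (u : (Fin N → ℤ) → ℝ) (d : (lattice N).Dart) :
    grad u (.inl d) = u d.snd - u d.fst := rfl

@[simp] lemma grad_inr (u : (Fin N → ℤ) → ℝ) (x : Fin N → ℤ) : grad u (.inr x) = u x := rfl

lemma weight_nonneg (hV : ∀ x, 0 ≤ V x) (c : Cell N) : 0 ≤ weight V c := by
  rcases c with _ | x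
  · exact one_half_pos.le
  · exact hV x

lemma density_nonneg (hV : ∀ x, 0 ≤ V x) (u : (Fin N → ℤ) → ℝ) (c : Cell N) :
    0 ≤ density p V u c := mul_nonneg (weight_nonneg hV c) (by positivity)

lemma normPow_nonneg (hV : ∀ x, 0 ≤ V x) (u : (Fin N → ℤ) → ℝ) : 0 ≤ normPow p V u :=
  add_nonneg (tsum_nonneg fun d => density_nonneg hV u (.inl d))
    (tsum_nonneg fun x => density_nonneg hV u (.inr x))

lemma normPow_eq_tsum_density (hu : Summable (density p V u)) :
    normPow p V u = ∑' c, density p V u c :=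
  (Summable.tsum_sum (hu.comp_injective Sum.inl_injective)
    (hu.comp_injective Sum.inr_injective)).symm

lemma density_smul (p a : ℝ) (V u : (Fin N → ℤ) → ℝ) (c : Cell N) :
    density p V (a • u) c = |a| ^ p * density p V u c := by
  rw [density, density, map_smul, Pi.smul_apply, smul_eq_mul, abs_mul,
    Real.mul_rpow (abs_nonneg _) (abs_nonneg _), mul_left_comm]

lemma normPow_smul (p a : ℝ) (V u : (Fin N → ℤ) → ℝ) :
    normPow p V (a • u) = |a| ^ p * normPow p V u :=
  (congrArg₂ (· + ·) ((tsum_congr fun d => density_smul p a V u (.inl d)).trans tsum_mul_left)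
    ((tsum_congr fun x => density_smul p a V u (.inr x)).trans tsum_mul_left)).trans
    (mul_add _ _ _).symm

lemma density_add_le (hp : 0 ≤ p) (hV : ∀ x, 0 ≤ V x) (u w : (Fin N → ℤ) → ℝ) (c : Cell N) :
    density p V (u + w) c ≤ 2 ^ p * (density p V u c + density p V w c) := by
  rw [density, density, density, map_add, ← mul_add, mul_left_comm]
  exact mul_le_mul_of_nonneg_left (abs_add_rpow_le hp _ _) (weight_nonneg hV c)

lemma density_le_density (hp : 0 ≤ p) (hV : ∀ x, 0 ≤ V x) {c : Cell N}
    (h : |grad w c| ≤ |grad u c|) : density p V w c ≤ density p V u c :=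
  mul_le_mul_of_nonneg_left (Real.rpow_le_rpow (abs_nonneg _) h hp) (weight_nonneg hV c)

lemma tendsto_density {ι : Type*} {l : Filter ι} {w : ι → (Fin N → ℤ) → ℝ} (hp : 0 ≤ p)
    (ht : ∀ x, Tendsto (fun n => w n x) l (𝓝 (u x))) (c : Cell N) :
    Tendsto (fun n => density p V (w n) c) l (𝓝 (density p V u c)) := by
  refine Tendsto.const_mul _ (Tendsto.rpow_const (Tendsto.abs ?_) (Or.inr hp))
  rcases c with d | x
  · exact (ht _).sub (ht _)
  · exact ht x

namespace HasFiniteEnergy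

lemma summable_gradient (hu : HasFiniteEnergy p V u) :
    Summable fun d : (lattice N).Dart => |u d.snd - u d.fst| ^ p :=
  ((hu.summable_density.comp_injective Sum.inl_injective).mul_left 2).congr fun d => by
    simp [density, weight]

lemma of_le (hp : 0 ≤ p) (hV : ∀ x, 0 ≤ V x) (hu : HasFiniteEnergy p V u)
    (h : ∀ c, |grad w c| ≤ |grad u c|) : HasFiniteEnergy p V w :=
  ⟨squeeze_zero_norm (fun x => h (.inr x)) (by simpa using hu.tendsto_zero.abs),
    .of_nonneg_of_le (density_nonneg hV w) (fun c => density_le_density hp hV (h c))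
      hu.summable_density⟩

lemma smul (hu : HasFiniteEnergy p V u) (a : ℝ) : HasFiniteEnergy p V (a • u) :=
  ⟨mul_zero a ▸ hu.tendsto_zero.const_mul a,
    (hu.summable_density.mul_left (|a| ^ p)).congr fun c => (density_smul p a V u c).symm⟩

lemma add (hp : 0 ≤ p) (hV : ∀ x, 0 ≤ V x) (hu : HasFiniteEnergy p V u)
    (hw : HasFiniteEnergy p V w) : HasFiniteEnergy p V (u + w) :=
  ⟨add_zero (0 : ℝ) ▸ hu.tendsto_zero.add hw.tendsto_zero,
    .of_nonneg_of_le (density_nonneg hV _) (density_add_le hp hV u w)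
      ((hu.summable_density.add hw.summable_density).mul_left _)⟩

lemma sub (hp : 0 ≤ p) (hV : ∀ x, 0 ≤ V x) (hu : HasFiniteEnergy p V u)
    (hw : HasFiniteEnergy p V w) : HasFiniteEnergy p V (u - w) := by
  simpa [sub_eq_add_neg] using hu.add hp hV (hw.smul (-1))

end HasFiniteEnergy

lemma normPow_le_of_density_le (hu : HasFiniteEnergy p V u) (hw : HasFiniteEnergy p V w)
    (h : ∀ c, density p V w c ≤ density p V u c) : normPow p V w ≤ normPow p V u := by
  rw [normPow_eq_tsum_density hu.summable_density, normPow_eq_tsum_density hw.summable_density]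
  exact hw.summable_density.tsum_le_tsum h hu.summable_density

lemma normPow_add_le (hp : 0 ≤ p) (hV : ∀ x, 0 ≤ V x) (hu : HasFiniteEnergy p V u)
    (hw : HasFiniteEnergy p V w) :
    normPow p V (u + w) ≤ 2 ^ p * (normPow p V u + normPow p V w) := by
  rw [normPow_eq_tsum_density (hu.add hp hV hw).summable_density,
    normPow_eq_tsum_density hu.summable_density, normPow_eq_tsum_density hw.summable_density,
    ← hu.summable_density.tsum_add hw.summable_density, ← tsum_mul_left]
  exact (hu.add hp hV hw).summable_density.tsum_le_tsum (density_add_le hp hV u w)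
    ((hu.summable_density.add hw.summable_density).mul_left _)

lemma normPow_sub_le (hp : 0 ≤ p) (hV : ∀ x, 0 ≤ V x) (hu : HasFiniteEnergy p V u)
    (hw : HasFiniteEnergy p V w) :
    normPow p V (u - w) ≤ 2 ^ p * (normPow p V u + normPow p V w) := by
  have h := normPow_add_le hp hV hu (hw.smul (-1))
  rwa [normPow_smul, neg_one_smul, ← sub_eq_add_neg, abs_neg, abs_one, Real.one_rpow,
    one_mul] at h

lemma finite_support_grad (hu : (Function.support u).Finite) :
    (Function.support (grad u)).Finite := by
  refine ((((finite_setOf_snd_mem hu).union (finite_setOf_fst_mem hu)).image Sum.inl).union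
    (hu.image Sum.inr)).subset ?_
  rintro (d | x) hc
  · refine Or.inl ⟨d, by_contra fun h => hc ?_, rfl⟩
    have h' : u d.snd = 0 ∧ u d.fst = 0 := by simpa using h
    rw [grad_inl, h'.1, h'.2, sub_zero]
  · exact Or.inr ⟨x, hc, rfl⟩

lemma HasFiniteEnergy.of_finite_support (hp : p ≠ 0) (hu : (Function.support u).Finite) :
    HasFiniteEnergy p V u :=
  ⟨tendsto_nhds_of_eventually_eq (by
      filter_upwards [hu.compl_mem_cofinite] with x hx using by simpa using hx),
    summable_comp_of_finite_support (finite_support_grad hu) (h := fun c t => weight V c * |t| ^ p)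
      fun _ => by simp [Real.zero_rpow hp]⟩

lemma abs_grad_comp_le {φ : ℝ → ℝ} (hφ : LipschitzWith 1 φ) (hφ0 : φ 0 = 0)
    (u : (Fin N → ℤ) → ℝ) (c : Cell N) : |grad (φ ∘ u) c| ≤ |grad u c| := by
  have h : ∀ a b, |φ a - φ b| ≤ |a - b| := fun a b => by
    simpa [Real.dist_eq] using hφ.dist_le_mul a b
  rcases c with d | x
  · exact h _ _
  · simpa [hφ0] using h (u x) 0

/-- Truncation of a real number to `[-ε, ε]`. -/
def clamp (ε a : ℝ) : ℝ := max (-ε) (min a ε)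

lemma lipschitzWith_clamp (ε : ℝ) : LipschitzWith 1 (clamp ε) :=
  (LipschitzWith.id.min_const ε).const_max (-ε)

lemma clamp_of_abs_le {ε a : ℝ} (h : |a| ≤ ε) : clamp ε a = a := by
  rw [clamp, min_eq_left (abs_le.1 h).2, max_eq_right (abs_le.1 h).1]

lemma clamp_zero {ε : ℝ} (hε : 0 ≤ ε) : clamp ε 0 = 0 := clamp_of_abs_le (by simpa)

lemma abs_clamp_le {ε : ℝ} (hε : 0 ≤ ε) (a : ℝ) : |clamp ε a| ≤ ε :=
  abs_le.2 ⟨le_max_left _ _, max_le (by linarith) (min_le_right _ _)⟩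

lemma HasFiniteEnergy.comp_clamp (hp : 0 ≤ p) (hV : ∀ x, 0 ≤ V x)
    (hu : HasFiniteEnergy p V u) {ε : ℝ} (hε : 0 ≤ ε) : HasFiniteEnergy p V (clamp ε ∘ u) :=
  hu.of_le hp hV (abs_grad_comp_le (lipschitzWith_clamp ε) (clamp_zero hε) u)

lemma normPow_clamp_le (hp : 0 ≤ p) (hV : ∀ x, 0 ≤ V x) (hu : HasFiniteEnergy p V u) {ε : ℝ}
    (hε : 0 ≤ ε) : normPow p V (clamp ε ∘ u) ≤ normPow p V u :=
  normPow_le_of_density_le hu (hu.comp_clamp hp hV hε) fun c =>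
    density_le_density hp hV (abs_grad_comp_le (lipschitzWith_clamp ε) (clamp_zero hε) u c)

lemma tendsto_clamp (a : ℝ) :
    Tendsto (fun n : ℕ => clamp (1 / ((n : ℝ) + 1)) a) atTop (𝓝 0) :=
  squeeze_zero_norm (fun _ => abs_clamp_le (by positivity) a)
    tendsto_one_div_add_atTop_nhds_zero_nat

lemma tendsto_normPow_clamp (hp : 0 < p) (hV : ∀ x, 0 ≤ V x) (hu : HasFiniteEnergy p V u) :
    Tendsto (fun n : ℕ => normPow p V (clamp (1 / ((n : ℝ) + 1)) ∘ u)) atTop (𝓝 0) := by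
  have hn : ∀ n : ℕ, (0 : ℝ) ≤ 1 / ((n : ℝ) + 1) := fun n => by positivity
  simp only [normPow_eq_tsum_density (hu.comp_clamp hp.le hV (hn _)).summable_density]
  have h0 : ∀ c, density p V (0 : (Fin N → ℤ) → ℝ) c = 0 := fun c => by
    simp [density, Real.zero_rpow hp.ne']
  have h := tendsto_tsum_of_dominated_convergence hu.summable_density
    (tendsto_density (V := V) (u := 0) (w := fun n : ℕ => clamp (1 / ((n : ℝ) + 1)) ∘ u) hp.le
      fun x => tendsto_clamp (u x))
    (.of_forall fun n c => by
      rw [Real.norm_of_nonneg (density_nonneg hV _ c)]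
      exact density_le_density hp.le hV
        (abs_grad_comp_le (lipschitzWith_clamp _) (clamp_zero (hn n)) u c))
  simpa only [h0, tsum_zero] using h

/-- Soft thresholding of `u` at level `1 / (n + 1)`, the standard approximation of a function
vanishing at infinity by finitely supported ones. -/
noncomputable def softThreshold (u : (Fin N → ℤ) → ℝ) (n : ℕ) : (Fin N → ℤ) → ℝ :=
  u - clamp (1 / ((n : ℝ) + 1)) ∘ u

lemma finite_support_softThreshold (hu : Tendsto u cofinite (𝓝 0)) (n : ℕ) :
    (Function.support (softThreshold u n)).Finite := by
  have h : ∀ᶠ x in cofinite, |u x| < 1 / ((n : ℝ) + 1) :=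
    (abs_zero (α := ℝ) ▸ hu.abs).eventually_lt_const (by positivity)
  refine (eventually_cofinite.1 h).subset fun x hx hlt => hx ?_
  rw [softThreshold, Pi.sub_apply, Function.comp_apply, clamp_of_abs_le hlt.le, sub_self]

lemma tendsto_softThreshold (u : (Fin N → ℤ) → ℝ) (x : Fin N → ℤ) :
    Tendsto (fun n => softThreshold u n x) atTop (𝓝 (u x)) := by
  simpa [softThreshold] using (tendsto_clamp (u x)).const_sub (u x)

lemma normPow_softThreshold_le (hp : 0 ≤ p) (hV : ∀ x, 0 ≤ V x) (hu : HasFiniteEnergy p V u)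
    (n : ℕ) : normPow p V (softThreshold u n) ≤ 2 ^ p * 2 * normPow p V u := by
  have hn : (0 : ℝ) ≤ 1 / ((n : ℝ) + 1) := by positivity
  calc normPow p V (softThreshold u n)
      ≤ 2 ^ p * (normPow p V u + normPow p V (clamp (1 / ((n : ℝ) + 1)) ∘ u)) :=
        normPow_sub_le hp hV hu (hu.comp_clamp hp hV hn)
    _ ≤ 2 ^ p * (normPow p V u + normPow p V u) := by
        gcongr
        exact normPow_clamp_le hp hV hu hn
    _ = 2 ^ p * 2 * normPow p V u := by ring

lemma tsum_gradient_le (hV : ∀ x, 0 ≤ V x) (u : (Fin N → ℤ) → ℝ) :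
    ∑' d : (lattice N).Dart, |u d.snd - u d.fst| ^ p ≤ 2 * normPow p V u := by
  have h : 0 ≤ ∑' x, V x * |u x| ^ p := tsum_nonneg fun x => density_nonneg hV u (.inr x)
  rw [normPow, tsum_mul_left]
  linarith

theorem exists_tsum_abs_rpow_pStar_le_normPow (hp : 1 < p) (hpN : p < N) (hV : ∀ x, 0 ≤ V x) :
    ∃ K > 0, ∀ u : (Fin N → ℤ) → ℝ, HasFiniteEnergy p V u →
      (Summable fun x => |u x| ^ pStar N p) ∧
      ∑' x, |u x| ^ pStar N p ≤ K * normPow p V u ^ (pStar N p / p) := by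
  obtain ⟨K, hK, hsob⟩ := exists_tsum_abs_rpow_pStar_le hp hpN
  have hp0 : 0 < p := by linarith
  have hps := pStar_pos hp0 hpN
  refine ⟨K * (2 * (2 ^ p * 2)) ^ (pStar N p / p), by positivity, fun u hu => ?_⟩
  have hfin := finite_support_softThreshold hu.tendsto_zero
  refine summable_and_tsum_le_of_tendsto (g := fun n x => |softThreshold u n x| ^ pStar N p)
    (fun _ _ => by positivity) (fun n => ?_) (.of_forall fun n => ?_)
    fun x => (tendsto_softThreshold u x).abs.rpow_const (Or.inr hps.le)
  · exact summable_comp_of_finite_support (hfin n) (h := fun _ t => |t| ^ pStar N p)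
      fun _ => by simp [hps.ne']
  · have hgrad : ∑' d : (lattice N).Dart,
        |softThreshold u n d.snd - softThreshold u n d.fst| ^ p ≤
          2 * (2 ^ p * 2) * normPow p V u :=
      (tsum_gradient_le hV _).trans (by linarith [normPow_softThreshold_le hp0.le hV hu n])
    rw [mul_assoc, ← Real.mul_rpow (by positivity) (normPow_nonneg hV u)]
    refine (hsob _ (hfin n)
      (HasFiniteEnergy.of_finite_support (V := V) hp0.ne' (hfin n)).summable_gradient).trans ?_
    gcongr

lemma HasFiniteEnergy.of_tendsto (hp : 1 < p) (hpN : p < N) (hV : ∀ x, 0 ≤ V x)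
    {w : ℕ → (Fin N → ℤ) → ℝ} {M : ℝ} (hw : ∀ n, HasFiniteEnergy p V (w n))
    (hM : ∀ᶠ n in atTop, normPow p V (w n) ≤ M)
    (ht : ∀ x, Tendsto (fun n => w n x) atTop (𝓝 (u x))) : HasFiniteEnergy p V u := by
  obtain ⟨K, hK, hsob⟩ := exists_tsum_abs_rpow_pStar_le_normPow hp hpN hV
  have hp0 : 0 < p := by linarith
  have hps := pStar_pos hp0 hpN
  have hbound : ∀ᶠ n in atTop, ∑' x, |w n x| ^ pStar N p ≤ K * M ^ (pStar N p / p) :=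
    hM.mono fun n hn => (hsob _ (hw n)).2.trans <| by
      gcongr
      exact normPow_nonneg hV _
  exact ⟨tendsto_cofinite_of_summable_rpow hps (summable_and_tsum_le_of_tendsto
      (fun _ _ => by positivity) (fun n => (hsob _ (hw n)).1) hbound
      fun x => (ht x).abs.rpow_const (Or.inr hps.le)).1,
    (summable_and_tsum_le_of_tendsto (fun n => density_nonneg hV (w n))
      (fun n => (hw n).summable_density)
      (hM.mono fun n hn => (normPow_eq_tsum_density (hw n).summable_density).ge.trans hn)
      (tendsto_density hp0.le ht)).1⟩

lemma eNorm_lt_iff (hp : 0 < p) (hV : ∀ x, 0 ≤ V x) {ε : ℝ} (hε : 0 < ε) :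
    eNorm p V u < ε ↔ normPow p V u < ε ^ p := by
  rw [eNorm, one_div, Real.rpow_inv_lt_iff_of_pos (normPow_nonneg hV u) hε.le hp]

lemma HasFiniteEnergy.of_mem_E (hp : 1 < p) (hpN : p < N) (hV : ∀ x, 0 ≤ V x)
    (hu : u ∈ E p V) : HasFiniteEnergy p V u := by
  obtain ⟨w, hfin, hcauchy, ht⟩ := hu
  have hp0 : 0 < p := by linarith
  obtain ⟨n₀, hn₀⟩ := hcauchy 1 one_pos
  have hw : ∀ n, HasFiniteEnergy p V (w n) := fun n => .of_finite_support hp0.ne' (hfin n)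
  refine of_tendsto hp hpN hV hw (M := 2 ^ p * (1 + normPow p V (w n₀))) ?_ ht
  filter_upwards [eventually_ge_atTop n₀] with n hn
  have hdiff : normPow p V (w n - w n₀) < 1 := by
    simpa using (eNorm_lt_iff hp0 hV one_pos).1 (hn₀ n hn n₀ le_rfl)
  have hadd := normPow_add_le hp0.le hV ((hw n).sub hp0.le hV (hw n₀)) (hw n₀)
  rw [sub_add_cancel] at hadd
  exact hadd.trans (by gcongr)

lemma HasFiniteEnergy.mem_E (hp : 0 < p) (hV : ∀ x, 0 ≤ V x) (hu : HasFiniteEnergy p V u) :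
    u ∈ E p V := by
  refine ⟨softThreshold u, finite_support_softThreshold hu.tendsto_zero, fun ε hε => ?_,
    tendsto_softThreshold u⟩
  have hη : 0 < ε ^ p / (2 ^ p * 2) := by positivity
  obtain ⟨n₀, hn₀⟩ :=
    eventually_atTop.1 ((tendsto_normPow_clamp hp hV hu).eventually_lt_const hη)
  refine ⟨n₀, fun m hm n hn => (eNorm_lt_iff hp hV hε).2 ?_⟩
  have hsub : softThreshold u m - softThreshold u n =
      clamp (1 / ((n : ℝ) + 1)) ∘ u - clamp (1 / ((m : ℝ) + 1)) ∘ u := by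
    simp [softThreshold]
  rw [hsub]
  calc _ ≤ 2 ^ p * (_ + _) := normPow_sub_le hp.le hV (hu.comp_clamp hp.le hV (by positivity))
        (hu.comp_clamp hp.le hV (by positivity))
    _ < 2 ^ p * (ε ^ p / (2 ^ p * 2) + ε ^ p / (2 ^ p * 2)) := by
        gcongr
        exacts [hn₀ n hn, hn₀ m hm]
    _ = ε ^ p := by field_simp; ring

theorem mem_E_iff (hp : 1 < p) (hpN : p < N) (hV : ∀ x, 0 ≤ V x) :
    u ∈ E p V ↔ HasFiniteEnergy p V u :=
  ⟨.of_mem_E hp hpN hV, fun hu => hu.mem_E (by linarith) hV⟩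

lemma normPow_pos (hp : 1 < p) (hpN : p < N) (hV : ∀ x, 0 ≤ V x) (hu : HasFiniteEnergy p V u)
    (h0 : u ≠ 0) : 0 < normPow p V u := by
  refine (normPow_nonneg hV u).lt_of_ne fun h => h0 ?_
  obtain ⟨K, -, hsob⟩ := exists_tsum_abs_rpow_pStar_le_normPow hp hpN hV
  have hps := pStar_pos (by linarith) hpN
  obtain ⟨hsum, hle⟩ := hsob u hu
  rw [← h, Real.zero_rpow (by positivity), mul_zero] at hle
  ext x
  have hx : |u x| ^ pStar N p ≤ 0 := (hsum.le_tsum x fun _ _ => by positivity).trans hle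
  simpa using (Real.rpow_eq_zero (abs_nonneg _) hps.ne').1 (hx.antisymm (by positivity))

lemma density_shift (p : ℝ) (u : (Fin N → ℤ) → ℝ) {z : Fin N → ℤ} (hz : ∀ x, V (x + z) = V x)
    (c : Cell N) : density p V (fun x => u (x + z)) c =
      density p V u ((dartShift z).sumCongr (Equiv.addRight z) c) := by
  rcases c with d | x
  · rfl
  · simp [density, weight, hz]

lemma HasFiniteEnergy.shift (hu : HasFiniteEnergy p V u) {z : Fin N → ℤ}
    (hz : ∀ x, V (x + z) = V x) : HasFiniteEnergy p V fun x => u (x + z) :=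
  ⟨hu.tendsto_zero.comp (add_left_injective z).tendsto_cofinite,
    ((Equiv.summable_iff _).2 hu.summable_density).congr fun c => (density_shift p u hz c).symm⟩

lemma normPow_shift (hu : HasFiniteEnergy p V u) {z : Fin N → ℤ} (hz : ∀ x, V (x + z) = V x) :
    normPow p V (fun x => u (x + z)) = normPow p V u := by
  rw [normPow_eq_tsum_density (hu.shift hz).summable_density,
    normPow_eq_tsum_density hu.summable_density, tsum_congr (density_shift p u hz)]
  exact Equiv.tsum_eq _ _

end FiniteEnergy

section BrezisLieb

variable {X : Type*}

lemma tendsto_tsum_max_sub_of_abs_le {D φ : ℕ → X → ℝ} {ψ : X → ℝ} (hφ : ∀ n x, 0 ≤ φ n x)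
    (hψ : Summable ψ) (hD : ∀ n x, |D n x| ≤ φ n x + ψ x)
    (ht : ∀ x, Tendsto (fun n => D n x) atTop (𝓝 0)) :
    Tendsto (fun n => ∑' x, max 0 (|D n x| - φ n x)) atTop (𝓝 0) := by
  suffices Tendsto (fun n => ∑' x, max 0 (|D n x| - φ n x)) atTop (𝓝 (∑' _ : X, (0 : ℝ))) by
    rwa [tsum_zero] at this
  refine tendsto_tsum_of_dominated_convergence hψ.abs (fun x => ?_) (.of_forall fun n x => ?_)
  · refine squeeze_zero (fun n => le_max_left _ _) (fun n => ?_)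
      (by simpa using (ht x).abs : Tendsto (fun n => |D n x|) atTop (𝓝 0))
    exact max_le (abs_nonneg _) (by linarith [hφ n x])
  · rw [Real.norm_of_nonneg (le_max_left _ _)]
    exact max_le (abs_nonneg _) (by linarith [hD n x, le_abs_self (ψ x)])

theorem tendsto_tsum_of_abs_le_mul_add {D φ : ℕ → X → ℝ} {ψ : X → ℝ} {K : ℝ}
    (hφ0 : ∀ n x, 0 ≤ φ n x) (hφ : ∀ n, Summable (φ n)) (hK : ∀ n, ∑' x, φ n x ≤ K)
    (hψ : Summable ψ) (hD : ∀ ε > 0, ∃ C, ∀ n x, |D n x| ≤ ε * φ n x + C * ψ x)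
    (ht : ∀ x, Tendsto (fun n => D n x) atTop (𝓝 0)) :
    Tendsto (fun n => ∑' x, D n x) atTop (𝓝 0) := by
  have hK0 : 0 ≤ K := (tsum_nonneg (hφ0 0)).trans (hK 0)
  refine Metric.tendsto_atTop.2 fun ε hε => ?_
  set η := ε / (2 * (K + 1)) with hη
  have hη0 : 0 < η := by positivity
  obtain ⟨C, hC⟩ := hD η hη0
  set R : ℕ → X → ℝ := fun n x => max 0 (|D n x| - η * φ n x)
  have hlim : Tendsto (fun n => ∑' x, R n x) atTop (𝓝 0) :=
    tendsto_tsum_max_sub_of_abs_le (fun n x => mul_nonneg hη0.le (hφ0 n x)) (hψ.mul_left C) hC ht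
  obtain ⟨n₀, hn₀⟩ := eventually_atTop.1 (hlim.eventually_lt_const (half_pos hε))
  refine ⟨n₀, fun n hn => ?_⟩
  have hR : Summable (R n) := (hψ.mul_left C).abs.of_nonneg_of_le (fun _ => le_max_left _ _)
    fun x => max_le (abs_nonneg _) (by linarith [hC n x, le_abs_self (C * ψ x)])
  have hle : ∀ x, |D n x| ≤ R n x + η * φ n x := fun x => by
    linarith [le_max_right 0 (|D n x| - η * φ n x)]
  have hDs : Summable fun x => |D n x| :=
    (hR.add ((hφ n).mul_left η)).of_nonneg_of_le (fun _ => abs_nonneg _) hle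
  rw [dist_zero_right]
  calc ‖∑' x, D n x‖ ≤ ∑' x, |D n x| := norm_tsum_le_tsum_norm hDs
    _ ≤ ∑' x, (R n x + η * φ n x) := hDs.tsum_le_tsum hle (hR.add ((hφ n).mul_left η))
    _ = ∑' x, R n x + η * ∑' x, φ n x := by
      rw [hR.tsum_add ((hφ n).mul_left η), tsum_mul_left]
    _ < ε / 2 + η * (K + 1) :=
      add_lt_add_of_lt_of_le (hn₀ n hn) (by gcongr; linarith [hK n])
    _ = ε := by rw [hη]; field_simp; ring

/-- Where `b` is not small compared with `a`, each of the three terms is of order `|b| ^ r`. -/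
lemma abs_split_le {h : ℝ → ℝ} {r C L M ε : ℝ} (hr : 0 ≤ r) (hC : 0 ≤ C) (hL : 0 ≤ L) (hε : 0 ≤ ε)
    (hbound : ∀ t, |t| ≤ 2 * M → |h t| ≤ C * |t| ^ r)
    (hnear : ∀ a b, |a| ≤ M → L * |b| < |a| → |h (a + b) - h a| ≤ ε * |a| ^ r)
    {a b : ℝ} (ha : |a| ≤ M) (hb : |b| ≤ M) :
    |h (a + b) - h a - h b| ≤ ε * |a| ^ r + C * ((L + 1) ^ r + L ^ r + 1) * |b| ^ r := by
  have hM : 0 ≤ M := (abs_nonneg a).trans ha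
  have hhb : |h b| ≤ C * |b| ^ r := hbound b (by linarith)
  have htri := abs_sub (h (a + b) - h a) (h b)
  rcases lt_or_ge (L * |b|) |a| with hlt | hge
  · have hn := hnear a b ha hlt
    have : 0 ≤ C * ((L + 1) ^ r + L ^ r) * |b| ^ r := by positivity
    linarith
  · have hha : |h a| ≤ C * (L * |b|) ^ r := (hbound a (by linarith)).trans (by gcongr)
    have hab : |a + b| ≤ (L + 1) * |b| := (abs_add_le a b).trans (by linarith)
    have hhab : |h (a + b)| ≤ C * ((L + 1) * |b|) ^ r :=
      (hbound _ ((abs_add_le a b).trans (by linarith))).trans (by gcongr)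
    rw [Real.mul_rpow (by positivity) (abs_nonneg _)] at hha hhab
    have hsub := abs_sub (h (a + b)) (h a)
    have : 0 ≤ ε * |a| ^ r := by positivity
    linarith

lemma exists_abs_rpow_add_sub_le {p : ℝ} (hp : 0 ≤ p) {ε : ℝ} (hε : 0 < ε) :
    ∃ L ≥ 0, ∀ a b : ℝ, L * |b| < |a| → |(|a + b| ^ p) - |a| ^ p| ≤ ε * |a| ^ p := by
  have hc : Continuous fun s : ℝ => |1 + s| ^ p :=
    (continuous_const.add continuous_id).abs.rpow_const fun _ => Or.inr hp
  obtain ⟨δ, hδ, hδ'⟩ := Metric.continuousAt_iff.1 (hc.continuousAt (x := 0)) ε hε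
  refine ⟨1 / δ, by positivity, fun a b hab => ?_⟩
  have ha : 0 < |a| := lt_of_le_of_lt (by positivity) hab
  have hscale : |a + b| ^ p = |1 + b / a| ^ p * |a| ^ p := by
    rw [← Real.mul_rpow (abs_nonneg _) (abs_nonneg _), ← abs_mul, add_mul, one_mul,
      div_mul_cancel₀ _ (abs_pos.1 ha)]
  have hclose : |(|1 + b / a| ^ p) - 1| < ε := by
    have hba : |b / a| < δ := by
      rwa [abs_div, div_lt_iff₀ ha, ← div_lt_iff₀' hδ, ← one_div_mul_eq_div]
    simpa [Real.dist_eq] using hδ' (by rwa [dist_zero_right, Real.norm_eq_abs])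
  rw [hscale, ← sub_one_mul, abs_mul, abs_of_nonneg (by positivity : 0 ≤ |a| ^ p)]
  gcongr

theorem exists_abs_rpow_split_le {p : ℝ} (hp : 0 ≤ p) {ε : ℝ} (hε : 0 < ε) :
    ∃ C, ∀ a b : ℝ, |(|a + b| ^ p) - |a| ^ p - |b| ^ p| ≤ ε * |a| ^ p + C * |b| ^ p := by
  obtain ⟨L, hL, hnear⟩ := exists_abs_rpow_add_sub_le hp hε
  refine ⟨1 * ((L + 1) ^ p + L ^ p + 1), fun a b => ?_⟩
  exact abs_split_le (h := fun t => |t| ^ p) (M := max |a| |b|) hp zero_le_one hL hε.le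
    (fun t _ => by rw [one_mul, abs_of_nonneg (by positivity)]) (fun a b _ => hnear a b)
    (le_max_left _ _) (le_max_right _ _)

variable {h : ℝ → ℝ} {r : ℝ}

lemma exists_abs_le_mul_abs_rpow (hr : 0 ≤ r) (hc : Continuous h)
    (ho : h =o[𝓝 0] fun t => |t| ^ r) (M : ℝ) : ∃ C ≥ 0, ∀ t, |t| ≤ M → |h t| ≤ C * |t| ^ r := by
  obtain ⟨δ, hδ, hsmall⟩ := Metric.eventually_nhds_iff.1 (ho.bound one_pos)
  obtain ⟨B, hB⟩ := isCompact_Icc.exists_bound_of_continuousOn (s := Set.Icc (-M) M) hc.continuousOn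
  refine ⟨1 + |B| / δ ^ r, by positivity, fun t ht => ?_⟩
  have ht0 : 0 ≤ |t| ^ r := by positivity
  rw [add_mul]
  rcases lt_or_ge |t| δ with hlt | hge
  · have : |h t| ≤ 1 * |t| ^ r := by
      simpa [abs_of_nonneg ht0] using hsmall (y := t) (by simpa using hlt)
    exact this.trans (le_add_of_nonneg_right (by positivity))
  · calc |h t| ≤ |B| := (hB t (abs_le.1 ht)).trans (le_abs_self B)
      _ = |B| / δ ^ r * δ ^ r := (div_mul_cancel₀ _ (by positivity)).symm
      _ ≤ |B| / δ ^ r * |t| ^ r := by gcongr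
      _ ≤ _ := le_add_of_nonneg_left (by positivity)

lemma exists_abs_add_sub_le_of_isLittleO (hr : 0 ≤ r) (hc : Continuous h)
    (ho : h =o[𝓝 0] fun t => |t| ^ r) {M : ℝ} (hM : 0 ≤ M) {ε : ℝ} (hε : 0 < ε) :
    ∃ L ≥ 0, ∀ a b, |a| ≤ M → L * |b| < |a| → |h (a + b) - h a| ≤ ε * |a| ^ r := by
  obtain ⟨η, hη, hsmall⟩ := Metric.eventually_nhds_iff.1
    (ho.bound (by positivity : 0 < ε / (2 ^ r + 1)))
  replace hsmall : ∀ t, |t| < η → |h t| ≤ ε / (2 ^ r + 1) * |t| ^ r := fun t ht => by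
    simpa [abs_of_nonneg (by positivity : 0 ≤ |t| ^ r)] using hsmall (y := t) (by simpa using ht)
  obtain ⟨δ, hδ, hunif⟩ := Metric.uniformContinuousOn_iff.1
    ((isCompact_Icc (a := -(2 * M)) (b := 2 * M)).uniformContinuousOn_of_continuous
      hc.continuousOn) (ε * (η / 2) ^ r) (by positivity)
  refine ⟨1 + M / δ, by positivity, fun a b ha hab => ?_⟩
  have hba : |b| ≤ |a| := by nlinarith [abs_nonneg b, div_nonneg hM hδ.le]
  have hadd : |a + b| ≤ 2 * |a| := (abs_add_le a b).trans (by linarith)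
  rcases lt_or_ge |a| (η / 2) with ha' | ha'
  · have h1 : |h a| ≤ ε / (2 ^ r + 1) * |a| ^ r := hsmall a (by linarith)
    have h2 : |h (a + b)| ≤ ε / (2 ^ r + 1) * (2 ^ r * |a| ^ r) := by
      rw [← Real.mul_rpow zero_le_two (abs_nonneg _)]
      exact (hsmall (a + b) (by linarith)).trans (by gcongr)
    calc |h (a + b) - h a| ≤ |h (a + b)| + |h a| := abs_sub _ _
      _ ≤ ε / (2 ^ r + 1) * (2 ^ r * |a| ^ r) + ε / (2 ^ r + 1) * |a| ^ r := add_le_add h2 h1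
      _ = ε * |a| ^ r := by field_simp
  · have hbδ : |b| < δ := by
      by_contra! hδb
      have : M ≤ M / δ * |b| := by
        rw [div_mul_eq_mul_div, le_div_iff₀ hδ]; gcongr
      linarith [abs_nonneg b]
    have hclose : |h (a + b) - h a| < ε * (η / 2) ^ r :=
      hunif _ (abs_le.1 (by linarith)) _ (abs_le.1 (by linarith))
        (by simpa [Real.dist_eq] using hbδ)
    exact hclose.le.trans (by gcongr)

theorem exists_abs_split_le_of_isLittleO (hr : 0 ≤ r) (hc : Continuous h)
    (ho : h =o[𝓝 0] fun t => |t| ^ r) {M : ℝ} (hM : 0 ≤ M) {ε : ℝ} (hε : 0 < ε) :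
    ∃ C, ∀ a b, |a| ≤ M → |b| ≤ M →
      |h (a + b) - h a - h b| ≤ ε * |a| ^ r + C * |b| ^ r := by
  obtain ⟨C, hC, hbound⟩ := exists_abs_le_mul_abs_rpow hr hc ho (2 * M)
  obtain ⟨L, hL, hnear⟩ := exists_abs_add_sub_le_of_isLittleO hr hc ho hM hε
  exact ⟨_, fun a b => abs_split_le hr hC hL hε.le hbound hnear⟩

end BrezisLieb

section Superlinear

variable {p : ℝ} {g φ : ℝ → ℝ}

lemma pos_of_strictMonoOn_div_rpow (hm : StrictMonoOn (fun s => φ s / s ^ (p - 1)) (Set.Ioi 0))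
    (h0 : Tendsto (fun s => φ s / s ^ (p - 1)) (𝓝[>] 0) (𝓝 0)) {s : ℝ} (hs : 0 < s) :
    0 < φ s := by
  have hnonneg : 0 ≤ φ (s / 2) / (s / 2) ^ (p - 1) := by
    refine le_of_tendsto h0 ?_
    filter_upwards [Ioo_mem_nhdsGT (half_pos hs)] with t ht
    exact (hm ht.1 (half_pos hs) ht.2).le
  exact (div_pos_iff_of_pos_right (by positivity)).1
    (hnonneg.trans_lt (hm (half_pos hs) hs (half_lt_self hs)))

lemma rpow_sub_one_div_mul_lt_integral (hp : 0 < p) (hφ : Continuous φ)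
    (hm : StrictMonoOn (fun s => φ s / s ^ (p - 1)) (Set.Ioi 0)) {s : ℝ} (hs : 0 ≤ s)
    (hs1 : s ≠ 1) : (s ^ p - 1) / p * φ 1 < ∫ t in (1 : ℝ)..s, φ t := by
  set Q : ℝ → ℝ := fun s => (∫ t in (1 : ℝ)..s, φ t) - (s ^ p - 1) / p * φ 1 with hQ
  have hderiv : ∀ t > 0, HasDerivAt Q ((φ t / t ^ (p - 1) - φ 1) * t ^ (p - 1)) t := by
    intro t ht
    have hpow := (((Real.hasDerivAt_rpow_const (p := p) (Or.inl ht.ne')).sub_const 1).div_const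
      p).mul_const (φ 1)
    have hint := intervalIntegral.integral_hasDerivAt_right (hφ.intervalIntegrable 1 t)
      hφ.stronglyMeasurable.stronglyMeasurableAtFilter hφ.continuousAt
    refine (hint.sub hpow).congr_deriv ?_
    have : t ^ (p - 1) ≠ 0 := by positivity
    field_simp
  have hcont : Continuous Q := by
    refine (intervalIntegral.continuous_primitive (fun a b => hφ.intervalIntegrable a b) 1).sub ?_
    exact (((Real.continuous_rpow_const hp.le).sub continuous_const).div_const p).mul_const _
  have hanti : StrictAntiOn Q (Set.Icc 0 1) := by
    refine strictAntiOn_of_deriv_neg (convex_Icc 0 1) hcont.continuousOn fun t ht => ?_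
    rw [interior_Icc] at ht
    have hlt : φ t / t ^ (p - 1) < φ 1 := by simpa using hm ht.1 (Set.mem_Ioi.2 one_pos) ht.2
    rw [(hderiv t ht.1).deriv]
    exact mul_neg_of_neg_of_pos (sub_neg.2 hlt) (Real.rpow_pos_of_pos ht.1 _)
  have hmono : StrictMonoOn Q (Set.Ici 1) := by
    refine strictMonoOn_of_deriv_pos (convex_Ici 1) hcont.continuousOn fun t ht => ?_
    rw [interior_Ici] at ht
    have ht0 : 0 < t := one_pos.trans ht
    have hlt : φ 1 < φ t / t ^ (p - 1) := by simpa using hm (Set.mem_Ioi.2 one_pos) ht0 ht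
    rw [(hderiv t ht0).deriv]
    exact mul_pos (sub_pos.2 hlt) (Real.rpow_pos_of_pos ht0 _)
  have hlt : Q 1 < Q s := by
    rcases lt_or_gt_of_ne hs1 with h | h
    · exact hanti ⟨hs, h.le⟩ ⟨zero_le_one, le_rfl⟩ h
    · exact hmono Set.self_mem_Ici h.le h
  simpa [hQ] using hlt

/-- The function `g` is superlinear of order `p - 1`: this is what `f (x, ·)` satisfies at each
site `x`. -/
structure IsSuperlinear (p : ℝ) (g : ℝ → ℝ) : Prop where
  continuous : Continuous g
  tendsto_zero : Tendsto (fun t => g t / |t| ^ (p - 1)) (𝓝[≠] 0) (𝓝 0)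
  strictMonoOn : StrictMonoOn (fun t => g t / |t| ^ (p - 1)) (Set.Iio 0 ∪ Set.Ioi 0)

/-- The function `t ↦ g t t / p - ∫₀ᵗ g`; its sum over the sites is the energy on the Nehari
manifold. -/
noncomputable def gap (p : ℝ) (g : ℝ → ℝ) (t : ℝ) : ℝ := g t * t / p - ∫ s in (0 : ℝ)..t, g s

lemma gap_zero (p : ℝ) (g : ℝ → ℝ) : gap p g 0 = 0 := by simp [gap]

namespace IsSuperlinear

variable {a s : ℝ}

/-- Along a ray in either direction from the origin, `g` behaves as on the positive half-line. -/
lemma ray_eq (ha : a ≠ 0) (hs : 0 < s) :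
    g (s * a) * a / s ^ (p - 1) = g (s * a) / |s * a| ^ (p - 1) * (|a| ^ (p - 1) * a) := by
  have : 0 < |a| := abs_pos.2 ha
  rw [abs_mul, abs_of_pos hs, Real.mul_rpow hs.le (abs_nonneg a)]
  field_simp

lemma strictMonoOn_ray (h : IsSuperlinear p g) (ha : a ≠ 0) :
    StrictMonoOn (fun s => g (s * a) * a / s ^ (p - 1)) (Set.Ioi 0) := by
  intro s hs t ht hst
  have hpow : 0 < |a| ^ (p - 1) := by positivity
  simp only [ray_eq ha hs, ray_eq ha ht]
  rcases ha.lt_or_gt with ha' | ha'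
  · refine mul_lt_mul_of_neg_right ?_ (mul_neg_of_pos_of_neg hpow ha')
    exact h.strictMonoOn (.inl (mul_neg_of_pos_of_neg ht ha'))
      (.inl (mul_neg_of_pos_of_neg hs ha')) (mul_lt_mul_of_neg_right hst ha')
  · refine mul_lt_mul_of_pos_right ?_ (mul_pos hpow ha')
    exact h.strictMonoOn (.inr (mul_pos hs ha')) (.inr (mul_pos ht ha'))
      (mul_lt_mul_of_pos_right hst ha')

lemma tendsto_ray (h : IsSuperlinear p g) (ha : a ≠ 0) :
    Tendsto (fun s => g (s * a) * a / s ^ (p - 1)) (𝓝[>] 0) (𝓝 0) := by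
  have hmul : Tendsto (fun s => s * a) (𝓝[>] 0) (𝓝[≠] 0) := by
    refine tendsto_nhdsWithin_iff.2 ⟨?_, ?_⟩
    · simpa using ((continuous_mul_const a).tendsto 0).mono_left nhdsWithin_le_nhds
    · filter_upwards [self_mem_nhdsWithin] with s hs using mul_ne_zero (ne_of_gt hs) ha
  have hlim := (h.tendsto_zero.comp hmul).mul_const (|a| ^ (p - 1) * a)
  rw [zero_mul] at hlim
  refine hlim.congr' ?_
  filter_upwards [self_mem_nhdsWithin] with s hs using (ray_eq ha hs).symm

lemma mul_self_pos (h : IsSuperlinear p g) (ha : a ≠ 0) : 0 < g a * a := by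
  simpa using pos_of_strictMonoOn_div_rpow (h.strictMonoOn_ray ha) (h.tendsto_ray ha) one_pos

lemma mul_self_nonneg (h : IsSuperlinear p g) (a : ℝ) : 0 ≤ g a * a := by
  rcases eq_or_ne a 0 with rfl | ha
  · simp
  · exact (h.mul_self_pos ha).le

lemma map_zero (h : IsSuperlinear p g) : g 0 = 0 := by
  refine le_antisymm ?_ ?_
  · refine le_of_tendsto (h.continuous.continuousWithinAt (s := Set.Iio 0)) ?_
    filter_upwards [self_mem_nhdsWithin] with t ht
    exact (neg_of_mul_pos_left (h.mul_self_pos (ne_of_lt ht)) (le_of_lt ht)).le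
  · refine ge_of_tendsto (h.continuous.continuousWithinAt (s := Set.Ioi 0)) ?_
    filter_upwards [self_mem_nhdsWithin] with t ht
    exact (pos_of_mul_pos_left (h.mul_self_pos (ne_of_gt ht)) (le_of_lt ht)).le

lemma mul_lt_rpow_mul (h : IsSuperlinear p g) (ha : a ≠ 0) (hs : 0 < s) (hs1 : s < 1) :
    g (s * a) * (s * a) < s ^ p * (g a * a) := by
  have hlt := h.strictMonoOn_ray ha hs (Set.mem_Ioi.2 one_pos) hs1
  simp only [one_mul, Real.one_rpow, div_one] at hlt
  rw [div_lt_iff₀ (by positivity)] at hlt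
  calc g (s * a) * (s * a) = g (s * a) * a * s := by ring
    _ < g a * a * s ^ (p - 1) * s := by gcongr
    _ = s ^ p * (g a * a) := by
      rw [mul_assoc, ← Real.rpow_add_one hs.ne', sub_add_cancel, mul_comm]

lemma rpow_mul_lt_mul (h : IsSuperlinear p g) (ha : a ≠ 0) (hs : 1 < s) :
    s ^ p * (g a * a) < g (s * a) * (s * a) := by
  have hs0 : 0 < s := one_pos.trans hs
  have hlt := h.mul_lt_rpow_mul (mul_ne_zero hs0.ne' ha) (inv_pos.2 hs0) (inv_lt_one_of_one_lt₀ hs)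
  rwa [inv_mul_cancel_left₀ hs0.ne', Real.inv_rpow hs0.le,
    lt_inv_mul_iff₀ (by positivity)] at hlt

lemma integral_mul_right (h : IsSuperlinear p g) (a s : ℝ) :
    ∫ t in (1 : ℝ)..s, g (t * a) * a = (∫ t in (0 : ℝ)..s * a, g t) - ∫ t in (0 : ℝ)..a, g t := by
  rw [intervalIntegral.integral_mul_const, mul_comm, intervalIntegral.mul_integral_comp_mul_right,
    one_mul, intervalIntegral.integral_interval_sub_left] <;>
  exact h.continuous.intervalIntegrable _ _

lemma rpow_sub_one_mul_lt (h : IsSuperlinear p g) (hp : 0 < p) (ha : a ≠ 0) (hs : 0 ≤ s)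
    (hs1 : s ≠ 1) : (s ^ p - 1) / p * (g a * a) <
      (∫ t in (0 : ℝ)..s * a, g t) - ∫ t in (0 : ℝ)..a, g t := by
  have hc : Continuous fun t => g (t * a) * a :=
    (h.continuous.comp (continuous_mul_const a)).mul_const a
  simpa [h.integral_mul_right] using
    rpow_sub_one_div_mul_lt_integral hp hc (h.strictMonoOn_ray ha) hs hs1

lemma rpow_sub_one_mul_le (h : IsSuperlinear p g) (hp : 0 < p) (a : ℝ) (hs : 0 ≤ s) :
    (s ^ p - 1) / p * (g a * a) ≤ (∫ t in (0 : ℝ)..s * a, g t) - ∫ t in (0 : ℝ)..a, g t := by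
  rcases eq_or_ne a 0 with rfl | ha
  · simp
  rcases eq_or_ne s 1 with rfl | hs1
  · simp
  · exact (h.rpow_sub_one_mul_lt hp ha hs hs1).le

lemma integral_nonneg (h : IsSuperlinear p g) (a : ℝ) : 0 ≤ ∫ t in (0 : ℝ)..a, g t := by
  have hneg := h.integral_mul_right a 0
  rw [intervalIntegral.integral_symm, zero_mul, intervalIntegral.integral_same, zero_sub,
    neg_inj] at hneg
  rw [← hneg]
  refine intervalIntegral.integral_nonneg zero_le_one fun t ht => ?_
  rcases ht.1.eq_or_lt with rfl | ht0
  · simp [h.map_zero]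
  · have := h.mul_self_nonneg (t * a)
    exact nonneg_of_mul_nonneg_left (by linarith : 0 ≤ g (t * a) * a * t) ht0

lemma gap_pos (h : IsSuperlinear p g) (hp : 0 < p) (ha : a ≠ 0) : 0 < gap p g a := by
  have hlt := h.rpow_sub_one_mul_lt hp ha le_rfl zero_ne_one
  simp only [Real.zero_rpow hp.ne', zero_mul, intervalIntegral.integral_same] at hlt
  rw [gap]
  linarith [show (0 - 1) / p * (g a * a) = -(g a * a / p) by ring]

lemma gap_nonneg (h : IsSuperlinear p g) (hp : 0 < p) (a : ℝ) : 0 ≤ gap p g a := by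
  rcases eq_or_ne a 0 with rfl | ha
  · exact (gap_zero p g).ge
  · exact (h.gap_pos hp ha).le

lemma integral_le (h : IsSuperlinear p g) (hp : 0 < p) (a : ℝ) :
    ∫ t in (0 : ℝ)..a, g t ≤ g a * a / p := sub_nonneg.1 (h.gap_nonneg hp a)

lemma gap_le (h : IsSuperlinear p g) (hp : 1 ≤ p) (a : ℝ) : gap p g a ≤ g a * a :=
  (sub_le_self _ (h.integral_nonneg a)).trans (div_le_self (h.mul_self_nonneg a) hp)

lemma gap_mul_le (h : IsSuperlinear p g) (hp : 0 < p) (a : ℝ) (hs : 0 < s) (hs1 : s ≤ 1) :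
    gap p g (s * a) ≤ gap p g a := by
  rcases eq_or_ne a 0 with rfl | ha
  · simp
  rcases hs1.eq_or_lt with rfl | hs1
  · rw [one_mul]
  have hg := div_le_div_of_nonneg_right (h.mul_lt_rpow_mul ha hs hs1).le hp.le
  have hG := h.rpow_sub_one_mul_le hp a hs.le
  rw [gap, gap]
  linarith [show (s ^ p - 1) / p * (g a * a) = s ^ p * (g a * a) / p - g a * a / p by ring]

lemma continuous_gap (h : IsSuperlinear p g) : Continuous (gap p g) :=
  ((h.continuous.mul continuous_id).div_const p).sub
    (intervalIntegral.continuous_primitive (fun a b => h.continuous.intervalIntegrable a b) 0)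

end IsSuperlinear

end Superlinear

section FiniteRange

variable {X : Type*}

lemma exists_forall_of_finite_range {Y : Type*} {h : X → Y} (hf : (Set.range h).Finite)
    {P : Y → ℝ → Prop} (hP : ∀ y, Monotone (P y)) (hex : ∀ x, ∃ C, P (h x) C) :
    ∃ C, ∀ x, P (h x) C := by
  have hev : ∀ y ∈ Set.range h, ∀ᶠ C in atTop, P y C := by
    rintro _ ⟨x, rfl⟩
    obtain ⟨C, hC⟩ := hex x
    filter_upwards [eventually_ge_atTop C] with D hD using hP _ hD hC
  obtain ⟨C, hC⟩ := ((eventually_all_finite hf).2 hev).exists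
  exact ⟨C, fun x => hC _ ⟨x, rfl⟩⟩

/-- Each member of the family `h` is continuous and `o(|t|^r)` at the origin. There are only
finitely many distinct members, so all resulting estimates are uniform over the family. -/
structure IsUniformlyLittleO (r : ℝ) (h : X → ℝ → ℝ) : Prop where
  finite_range : (Set.range h).Finite
  continuous : ∀ x, Continuous (h x)
  isLittleO : ∀ x, h x =o[𝓝 0] fun t => |t| ^ r

namespace IsUniformlyLittleO

variable {h : X → ℝ → ℝ} {r M : ℝ}

lemma exists_abs_le (hh : IsUniformlyLittleO r h) (hr : 0 ≤ r) (M : ℝ) :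
    ∃ C ≥ 0, ∀ x t, |t| ≤ M → |h x t| ≤ C * |t| ^ r := by
  obtain ⟨C, hC⟩ := exists_forall_of_finite_range hh.finite_range
    (P := fun g C => ∀ t, |t| ≤ M → |g t| ≤ C * |t| ^ r)
    (fun g C D hCD hC t ht => (hC t ht).trans (by gcongr)) fun x =>
      (exists_abs_le_mul_abs_rpow hr (hh.continuous x) (hh.isLittleO x) M).imp fun C hC => hC.2
  refine ⟨max C 0, le_max_right C 0, fun x t ht => (hC x t ht).trans ?_⟩
  gcongr
  exact le_max_left C 0

lemma map_zero (hh : IsUniformlyLittleO r h) (hr : 0 < r) (x : X) : h x 0 = 0 := by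
  obtain ⟨C, -, hC⟩ := hh.exists_abs_le hr.le 0
  simpa [Real.zero_rpow hr.ne'] using hC x 0 (by simp)

lemma exists_abs_split_le (hh : IsUniformlyLittleO r h) (hr : 0 ≤ r) (hM : 0 ≤ M) {ε : ℝ}
    (hε : 0 < ε) : ∃ C, ∀ x a b, |a| ≤ M → |b| ≤ M →
      |h x (a + b) - h x a - h x b| ≤ ε * |a| ^ r + C * |b| ^ r :=
  exists_forall_of_finite_range hh.finite_range
    (P := fun g C => ∀ a b, |a| ≤ M → |b| ≤ M →
      |g (a + b) - g a - g b| ≤ ε * |a| ^ r + C * |b| ^ r)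
    (fun g C D hCD hC a b ha hb => (hC a b ha hb).trans (by gcongr))
    fun x => exists_abs_split_le_of_isLittleO hr (hh.continuous x) (hh.isLittleO x) hM hε

end IsUniformlyLittleO

end FiniteRange

/-- The standing assumptions on the potential and the nonlinearity. Periodicity of `f` enters most
arguments only through the fact that `f (x, ·)` runs through finitely many functions. -/
structure Admissible {N : ℕ} (p : ℝ) (V : (Fin N → ℤ) → ℝ) (f : (Fin N → ℤ) → ℝ → ℝ) :
    Prop where
  one_lt : 1 < p
  lt_dim : p < N
  nonneg : ∀ x, 0 ≤ V x
  finite_range : (Set.range f).Finite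
  continuous : ∀ x, Continuous (f x)
  small : ∀ ε > 0, ∃ δ > 0, ∀ x t, 0 < |t| → |t| < δ → |f x t| ≤ ε * |t| ^ (pStar N p - 1)
  strictMonoOn : ∀ x, StrictMonoOn (fun t => f x t / |t| ^ (p - 1)) (Set.Iio 0 ∪ Set.Ioi 0)
  superlinear : ∀ M : ℝ, ∃ R > 0, ∀ x t, R < |t| → M ≤ primitive f x t / |t| ^ p

/-- The Nehari functional `⟨Φ'(u), u⟩ = ‖u‖ ^ p - ∑ f (x, u x) u x`. -/
noncomputable def nehariFn {N : ℕ} (p : ℝ) (V : (Fin N → ℤ) → ℝ) (f : (Fin N → ℤ) → ℝ → ℝ)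
    (u : (Fin N → ℤ) → ℝ) : ℝ :=
  normPow p V u - ∑' x, f x (u x) * u x

lemma energyDeriv_self {N : ℕ} {p : ℝ} (hp : p ≠ 0) (V : (Fin N → ℤ) → ℝ)
    (f : (Fin N → ℤ) → ℝ → ℝ) (u : (Fin N → ℤ) → ℝ) :
    energyDeriv p V f u u = nehariFn p V f u := by
  have hV : ∀ x, V x * |u x| ^ (p - 2) * u x * u x = V x * |u x| ^ p := fun x => by
    rw [← abs_rpow_sub_two_mul_mul hp, mul_assoc, mul_assoc, mul_assoc]
  simp only [energyDeriv, nehariFn, normPow, abs_rpow_sub_two_mul_mul hp, hV]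

namespace Admissible

variable {N : ℕ} {p : ℝ} {V u : (Fin N → ℤ) → ℝ} {f : (Fin N → ℤ) → ℝ → ℝ}

section Nonlinearity

lemma pos (A : Admissible p V f) : 0 < p := one_pos.trans A.one_lt

lemma lt_pStar (A : Admissible p V f) : p < pStar N p := LatticePLaplace.lt_pStar A.pos A.lt_dim

lemma pStar_pos (A : Admissible p V f) : 0 < pStar N p := LatticePLaplace.pStar_pos A.pos A.lt_dim

lemma exists_abs_mul_self_le (A : Admissible p V f) {ε : ℝ} (hε : 0 < ε) :
    ∃ δ > 0, ∀ x t, |t| < δ → |f x t * t| ≤ ε * |t| ^ pStar N p := by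
  obtain ⟨δ, hδ, h⟩ := A.small ε hε
  refine ⟨δ, hδ, fun x t ht => ?_⟩
  rcases eq_or_ne t 0 with rfl | h0
  · simp [Real.zero_rpow A.pStar_pos.ne']
  have ht0 := abs_pos.2 h0
  calc |f x t * t| = |f x t| * |t| := abs_mul _ _
    _ ≤ ε * |t| ^ (pStar N p - 1) * |t| := by gcongr; exact h x t ht0 ht
    _ = ε * |t| ^ pStar N p := by rw [mul_assoc, ← Real.rpow_add_one ht0.ne', sub_add_cancel]

lemma isSuperlinear (A : Admissible p V f) (x : Fin N → ℤ) : IsSuperlinear p (f x) where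
  continuous := A.continuous x
  strictMonoOn := A.strictMonoOn x
  tendsto_zero := by
    obtain ⟨δ, hδ, h⟩ := A.small 1 one_pos
    have hexp : 0 < pStar N p - p := sub_pos.2 A.lt_pStar
    have hlim : Tendsto (fun t : ℝ => |t| ^ (pStar N p - p)) (𝓝[≠] 0) (𝓝 0) := by
      have hc : Continuous fun t : ℝ => |t| ^ (pStar N p - p) :=
        continuous_abs.rpow_const fun _ => Or.inr hexp.le
      simpa [Real.zero_rpow hexp.ne'] using (hc.tendsto 0).mono_left nhdsWithin_le_nhds
    refine squeeze_zero_norm' ?_ hlim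
    filter_upwards [self_mem_nhdsWithin, nhdsWithin_le_nhds (Metric.ball_mem_nhds 0 hδ)]
      with t h0 ht
    have ht0 : 0 < |t| := abs_pos.2 h0
    have hpow : 0 < |t| ^ (p - 1) := Real.rpow_pos_of_pos ht0 _
    rw [norm_div, Real.norm_eq_abs, Real.norm_of_nonneg hpow.le, div_le_iff₀ hpow,
      ← Real.rpow_add ht0, sub_add_sub_cancel, ← one_mul (|t| ^ _)]
    exact h x t ht0 (by simpa using ht)

lemma isUniformlyLittleO_mul_self (A : Admissible p V f) :
    IsUniformlyLittleO (pStar N p) fun x t => f x t * t where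
  finite_range := Set.range_comp (fun g t => g t * t) f ▸ A.finite_range.image _
  continuous x := (A.continuous x).mul continuous_id
  isLittleO x := by
    refine Asymptotics.isLittleO_iff.2 fun ε hε => ?_
    obtain ⟨δ, hδ, h⟩ := A.exists_abs_mul_self_le hε
    filter_upwards [Metric.ball_mem_nhds 0 hδ] with t ht
    rw [Real.norm_eq_abs, Real.norm_of_nonneg (by positivity)]
    exact h x t (by simpa using ht)

lemma isUniformlyLittleO_gap (A : Admissible p V f) :
    IsUniformlyLittleO (pStar N p) fun x => gap p (f x) where
  finite_range := Set.range_comp (gap p) f ▸ A.finite_range.image _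
  continuous x := (A.isSuperlinear x).continuous_gap
  isLittleO x := (Asymptotics.isBigO_of_le _ fun t => abs_le_abs_of_nonneg
    ((A.isSuperlinear x).gap_nonneg A.pos t)
    ((A.isSuperlinear x).gap_le A.one_lt.le t)).trans_isLittleO
      (A.isUniformlyLittleO_mul_self.isLittleO x)

end Nonlinearity

section Energy

lemma mem_nehari (A : Admissible p V f) :
    u ∈ nehari p V f ↔ HasFiniteEnergy p V u ∧ u ≠ 0 ∧ nehariFn p V f u = 0 := by
  rw [← energyDeriv_self A.pos.ne', ← mem_E_iff A.one_lt A.lt_dim A.nonneg]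
  rfl

lemma summable_rpow (A : Admissible p V f) (hu : HasFiniteEnergy p V u) :
    Summable fun x => |u x| ^ pStar N p := by
  obtain ⟨K, -, hK⟩ := exists_tsum_abs_rpow_pStar_le_normPow A.one_lt A.lt_dim A.nonneg
  exact (hK u hu).1

lemma exists_tsum_rpow_le (A : Admissible p V f) (M : ℝ) :
    ∃ C, ∀ u, HasFiniteEnergy p V u → normPow p V u ≤ M → ∑' x, |u x| ^ pStar N p ≤ C := by
  obtain ⟨K, hK0, hK⟩ := exists_tsum_abs_rpow_pStar_le_normPow A.one_lt A.lt_dim A.nonneg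
  refine ⟨K * M ^ (pStar N p / p), fun u hu hM => (hK u hu).2.trans ?_⟩
  have := normPow_nonneg (p := p) A.nonneg u
  have := div_nonneg A.pStar_pos.le A.pos.le
  gcongr

lemma exists_abs_le (A : Admissible p V f) (M : ℝ) :
    ∃ B ≥ 0, ∀ u, HasFiniteEnergy p V u → normPow p V u ≤ M → ∀ x, |u x| ≤ B := by
  obtain ⟨C, hC⟩ := A.exists_tsum_rpow_le M
  refine ⟨max C 0 ^ (1 / pStar N p), by positivity, fun u hu hM x => ?_⟩
  have hx : |u x| ^ pStar N p ≤ max C 0 :=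
    ((A.summable_rpow hu).le_tsum x fun _ _ => by positivity).trans
      ((hC u hu hM).trans (le_max_left C 0))
  rwa [one_div, Real.le_rpow_inv_iff_of_pos (abs_nonneg _) (le_max_right C 0) A.pStar_pos]

lemma summable_comp (A : Admissible p V f) {h : (Fin N → ℤ) → ℝ → ℝ}
    (hh : IsUniformlyLittleO (pStar N p) h) (hu : HasFiniteEnergy p V u) :
    Summable fun x => h x (u x) := by
  obtain ⟨B, -, hB⟩ := A.exists_abs_le (normPow p V u)
  obtain ⟨C, -, hC⟩ := hh.exists_abs_le A.pStar_pos.le B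
  exact Summable.of_norm_bounded ((A.summable_rpow hu).mul_left C)
    fun x => hC x _ (hB u hu le_rfl x)

lemma summable_mul_self (A : Admissible p V f) (hu : HasFiniteEnergy p V u) :
    Summable fun x => f x (u x) * u x :=
  A.summable_comp (h := fun x t => f x t * t) A.isUniformlyLittleO_mul_self hu

lemma summable_gap (A : Admissible p V f) (hu : HasFiniteEnergy p V u) :
    Summable fun x => gap p (f x) (u x) :=
  A.summable_comp A.isUniformlyLittleO_gap hu

lemma summable_primitive (A : Admissible p V f) (hu : HasFiniteEnergy p V u) :
    Summable fun x => primitive f x (u x) :=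
  .of_nonneg_of_le (fun x => (A.isSuperlinear x).integral_nonneg _)
    (fun x => (A.isSuperlinear x).integral_le A.pos _) ((A.summable_mul_self hu).div_const p)

lemma tsum_gap_pos (A : Admissible p V f) (hu : HasFiniteEnergy p V u) (h0 : u ≠ 0) :
    0 < ∑' x, gap p (f x) (u x) := by
  obtain ⟨x, hx⟩ := Function.ne_iff.1 h0
  exact (A.summable_gap hu).tsum_pos (fun y => (A.isSuperlinear y).gap_nonneg A.pos _) x
    ((A.isSuperlinear x).gap_pos A.pos hx)

lemma energy_eq (A : Admissible p V f) (hu : HasFiniteEnergy p V u) :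
    energy p V f u = nehariFn p V f u / p + ∑' x, gap p (f x) (u x) := by
  have hgap : ∑' x, gap p (f x) (u x) =
      (∑' x, f x (u x) * u x) / p - ∑' x, primitive f x (u x) := by
    rw [← tsum_div_const, ← ((A.summable_mul_self hu).div_const p).tsum_sub
      (A.summable_primitive hu)]
    rfl
  rw [hgap, energy, nehariFn]
  ring

lemma energy_eq_tsum_gap (A : Admissible p V f) (hu : u ∈ nehari p V f) :
    energy p V f u = ∑' x, gap p (f x) (u x) := by
  obtain ⟨h, -, h0⟩ := A.mem_nehari.1 hu
  rw [A.energy_eq h, h0, zero_div, zero_add]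

end Energy

section FiberMap

variable {s : ℝ}

lemma normPow_eq_tsum (A : Admissible p V f) (hu : u ∈ nehari p V f) :
    normPow p V u = ∑' x, f x (u x) * u x := sub_eq_zero.1 (A.mem_nehari.1 hu).2.2

lemma energy_smul_lt (A : Admissible p V f) (hu : u ∈ nehari p V f) (hs : 0 ≤ s) (hs1 : s ≠ 1) :
    energy p V f (s • u) < energy p V f u := by
  obtain ⟨h, h0, -⟩ := A.mem_nehari.1 hu
  obtain ⟨x₀, hx₀⟩ := Function.ne_iff.1 h0
  have hlt : ∑' x, (s ^ p - 1) / p * (f x (u x) * u x) <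
      ∑' x, (primitive f x ((s • u) x) - primitive f x (u x)) :=
    ((A.summable_mul_self h).mul_left _).tsum_lt_tsum (i := x₀)
      (fun x => (A.isSuperlinear x).rpow_sub_one_mul_le A.pos (u x) hs)
      ((A.isSuperlinear x₀).rpow_sub_one_mul_lt A.pos hx₀ hs hs1)
      ((A.summable_primitive (h.smul s)).sub (A.summable_primitive h))
  rw [tsum_mul_left, ← A.normPow_eq_tsum hu,
    (A.summable_primitive (h.smul s)).tsum_sub (A.summable_primitive h)] at hlt
  rw [energy, energy, normPow_smul, abs_of_nonneg hs]
  linear_combination hlt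

lemma energy_smul_le (A : Admissible p V f) (hu : u ∈ nehari p V f) (hs : 0 ≤ s) :
    energy p V f (s • u) ≤ energy p V f u := by
  rcases eq_or_ne s 1 with rfl | h
  · rw [one_smul]
  · exact (A.energy_smul_lt hu hs h).le

lemma nehariFn_smul_pos (A : Admissible p V f) (hu : u ∈ nehari p V f) (hs : 0 < s)
    (hs1 : s < 1) : 0 < nehariFn p V f (s • u) := by
  obtain ⟨h, h0, -⟩ := A.mem_nehari.1 hu
  obtain ⟨x₀, hx₀⟩ := Function.ne_iff.1 h0
  have hlt : ∀ x, u x ≠ 0 → f x (s * u x) * (s * u x) < s ^ p * (f x (u x) * u x) :=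
    fun x hx => (A.isSuperlinear x).mul_lt_rpow_mul hx hs hs1
  rw [nehariFn, normPow_smul, abs_of_pos hs, A.normPow_eq_tsum hu, ← tsum_mul_left, sub_pos]
  refine (A.summable_mul_self (h.smul s)).tsum_lt_tsum (i := x₀) (fun x => ?_) (hlt x₀ hx₀)
    ((A.summable_mul_self h).mul_left _)
  by_cases hx : u x = 0
  · simp [hx]
  · exact (hlt x hx).le

lemma nehariFn_smul_neg (A : Admissible p V f) (hu : u ∈ nehari p V f) (hs : 1 < s) :
    nehariFn p V f (s • u) < 0 := by
  obtain ⟨h, h0, -⟩ := A.mem_nehari.1 hu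
  obtain ⟨x₀, hx₀⟩ := Function.ne_iff.1 h0
  have hlt : ∀ x, u x ≠ 0 → s ^ p * (f x (u x) * u x) < f x (s * u x) * (s * u x) :=
    fun x hx => (A.isSuperlinear x).rpow_mul_lt_mul hx hs
  rw [nehariFn, normPow_smul, abs_of_pos (one_pos.trans hs), A.normPow_eq_tsum hu,
    ← tsum_mul_left, sub_neg]
  refine ((A.summable_mul_self h).mul_left _).tsum_lt_tsum (i := x₀) (fun x => ?_) (hlt x₀ hx₀)
    (A.summable_mul_self (h.smul s))
  by_cases hx : u x = 0
  · simp [hx]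
  · exact (hlt x hx).le

lemma continuousOn_nehariFn_smul (A : Admissible p V f) (hu : HasFiniteEnergy p V u) (R : ℝ) :
    ContinuousOn (fun t : ℝ => nehariFn p V f (t • u)) (Set.Icc 0 R) := by
  obtain ⟨B, -, hB⟩ := A.exists_abs_le (normPow p V u)
  obtain ⟨C, hC0, hC⟩ :=
    A.isUniformlyLittleO_mul_self.exists_abs_le A.pStar_pos.le (R * B)
  have hs := A.pStar_pos
  refine ContinuousOn.sub ?_ ?_
  · simp only [normPow_smul]
    exact ((continuous_abs.rpow_const fun _ => Or.inr A.pos.le).mul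
      continuous_const).continuousOn
  · refine continuousOn_tsum (u := fun x => C * (R ^ pStar N p * |u x| ^ pStar N p)) (fun x => ?_)
      (((A.summable_rpow hu).mul_left _).mul_left C) fun x t ht => ?_
    · exact ((A.isUniformlyLittleO_mul_self.continuous x).comp
        (continuous_id.mul continuous_const)).continuousOn
    · have hR : 0 ≤ R := ht.1.trans ht.2
      have htu : |t * u x| ≤ R * |u x| := by
        rw [abs_mul, abs_of_nonneg ht.1]
        exact mul_le_mul_of_nonneg_right ht.2 (abs_nonneg _)
      refine (hC x (t * u x) (htu.trans ?_)).trans ?_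
      · exact mul_le_mul_of_nonneg_left (hB u hu le_rfl x) hR
      · rw [← Real.mul_rpow hR (abs_nonneg _)]
        gcongr

lemma tsum_mul_self_le (A : Admissible p V f) (hu : HasFiniteEnergy p V u)
    (h : ∀ x, |f x (u x) * u x| ≤ |u x| ^ pStar N p) :
    ∑' x, f x (u x) * u x ≤ ∑' x, |u x| ^ pStar N p :=
  (A.summable_mul_self hu).tsum_le_tsum (fun x => (le_abs_self _).trans (h x)) (A.summable_rpow hu)

lemma exists_small_scale (A : Admissible p V f) (hu : HasFiniteEnergy p V u) (h0 : u ≠ 0) :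
    ∃ t : ℝ, 0 < t ∧ t < 1 ∧ 0 < nehariFn p V f (t • u) := by
  obtain ⟨B, -, hB⟩ := A.exists_abs_le (normPow p V u)
  obtain ⟨δ, hδ, h⟩ := A.exists_abs_mul_self_le one_pos
  have hr : 0 < pStar N p - p := sub_pos.2 A.lt_pStar
  set S := ∑' x, |u x| ^ pStar N p
  have hid : Tendsto (fun t : ℝ => t) (𝓝[>] 0) (𝓝 0) := nhdsWithin_le_nhds
  have hsmall : ∀ᶠ t in 𝓝[>] (0 : ℝ), t * B < δ :=
    (hid.mul_const B).eventually_lt_const (by rwa [zero_mul])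
  have hdom : ∀ᶠ t in 𝓝[>] (0 : ℝ), t ^ (pStar N p - p) * S < normPow p V u :=
    ((hid.rpow_const (Or.inr hr.le)).mul_const S).eventually_lt_const
      (by simpa [Real.zero_rpow hr.ne'] using normPow_pos A.one_lt A.lt_dim A.nonneg hu h0)
  obtain ⟨t, ⟨htB, htS⟩, ht, ht1⟩ :=
    ((hsmall.and hdom).and (Ioo_mem_nhdsGT (one_pos (α := ℝ)))).exists
  refine ⟨t, ht, ht1, ?_⟩
  have habs : ∀ x, |(t • u) x| = t * |u x| := fun x => by
    rw [Pi.smul_apply, smul_eq_mul, abs_mul, abs_of_pos ht]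
  have hle := A.tsum_mul_self_le (hu.smul t) fun x => by
    simpa using h x ((t • u) x) (by
      rw [habs]
      exact (mul_le_mul_of_nonneg_left (hB u hu le_rfl x) ht.le).trans_lt htB)
  simp only [habs, Real.mul_rpow ht.le (abs_nonneg _), tsum_mul_left] at hle
  rw [nehariFn, normPow_smul, abs_of_pos ht, sub_pos]
  calc ∑' x, f x ((t • u) x) * (t • u) x ≤ t ^ pStar N p * S := hle
    _ = t ^ p * (t ^ (pStar N p - p) * S) := by
      rw [← mul_assoc, ← Real.rpow_add ht, add_sub_cancel]
    _ < t ^ p * normPow p V u := by gcongr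

lemma exists_large_scale (A : Admissible p V f) (hu : HasFiniteEnergy p V u) (h0 : u ≠ 0) :
    ∃ t : ℝ, 0 < t ∧ nehariFn p V f (t • u) ≤ 0 := by
  obtain ⟨x₀, hx₀⟩ := Function.ne_iff.1 h0
  have hx : 0 < |u x₀| := abs_pos.2 hx₀
  obtain ⟨R, hR, h⟩ := A.superlinear (normPow p V u / |u x₀| ^ p)
  set t := (R + 1) / |u x₀| with htdef
  have ht : 0 < t := by positivity
  have htx : |t * u x₀| = R + 1 := by
    rw [abs_mul, abs_of_pos ht, htdef, div_mul_cancel₀ _ hx.ne']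
  have hlarge := h x₀ (t * u x₀) (by rw [htx]; linarith)
  rw [abs_mul, abs_of_pos ht, Real.mul_rpow ht.le hx.le, le_div_iff₀ (by positivity)] at hlarge
  refine ⟨t, ht, ?_⟩
  rw [nehariFn, normPow_smul, abs_of_pos ht, sub_nonpos]
  have hA := A.isSuperlinear x₀
  calc t ^ p * normPow p V u = normPow p V u / |u x₀| ^ p * (t ^ p * |u x₀| ^ p) := by
        field_simp
    _ ≤ primitive f x₀ (t * u x₀) := hlarge
    _ ≤ f x₀ (t * u x₀) * (t * u x₀) / p := hA.integral_le A.pos _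
    _ ≤ f x₀ (t * u x₀) * (t * u x₀) := div_le_self (hA.mul_self_nonneg _) A.one_lt.le
    _ ≤ ∑' x, f x ((t • u) x) * (t • u) x :=
      (A.summable_mul_self (hu.smul t)).le_tsum x₀ fun x _ =>
        (A.isSuperlinear x).mul_self_nonneg _

lemma exists_smul_mem_nehari_of_nonpos (A : Admissible p V f) (hu : HasFiniteEnergy p V u)
    (h0 : u ≠ 0) (hn : nehariFn p V f u ≤ 0) :
    ∃ t : ℝ, 0 < t ∧ t ≤ 1 ∧ t • u ∈ nehari p V f := by
  obtain ⟨s, hs0, hs1, hs⟩ := A.exists_small_scale hu h0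
  have hc := (A.continuousOn_nehariFn_smul hu 1).mono (Set.Icc_subset_Icc_left hs0.le)
  obtain ⟨t, ht, hte⟩ := intermediate_value_Icc' hs1.le hc
    (show (0 : ℝ) ∈ _ from ⟨by simpa using hn, hs.le⟩)
  have ht0 : 0 < t := hs0.trans_le ht.1
  exact ⟨t, ht0, ht.2, A.mem_nehari.2 ⟨hu.smul t, smul_ne_zero ht0.ne' h0, hte⟩⟩

lemma exists_smul_mem_nehari (A : Admissible p V f) (hu : HasFiniteEnergy p V u) (h0 : u ≠ 0) :
    ∃ t : ℝ, 0 < t ∧ t • u ∈ nehari p V f := by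
  obtain ⟨s, hs, hn⟩ := A.exists_large_scale hu h0
  obtain ⟨t, ht, -, h⟩ :=
    A.exists_smul_mem_nehari_of_nonpos (hu.smul s) (smul_ne_zero hs.ne' h0) hn
  exact ⟨t * s, mul_pos ht hs, by rwa [mul_smul]⟩

end FiberMap

end Admissible

section Periodic

variable {N T : ℕ} {β : Type*} {h : (Fin N → ℤ) → β}

lemma IsPeriodic.periodic_smul (hh : IsPeriodic T h) (k : Fin N → ℤ) :
    Function.Periodic h ((T : ℤ) • k) := by
  have hk : (T : ℤ) • k = ∑ i, k i • (Pi.single i (T : ℤ) : Fin N → ℤ) := by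
    ext j
    simp [Finset.sum_apply, Pi.single_apply, mul_comm]
  rw [hk]
  refine Finset.sum_induction _ (Function.Periodic h) (fun _ _ => Function.Periodic.add_period)
    (fun x => by rw [add_zero]) fun i _ => ?_
  exact Function.Periodic.zsmul (fun x => hh x i) (k i)

lemma exists_add_smul_mem_Icc (hT : 0 < T) (x : Fin N → ℤ) :
    ∃ k : Fin N → ℤ, x + (T : ℤ) • k ∈ Set.Icc (0 : Fin N → ℤ) (fun _ => (T : ℤ)) := by
  have hT' : (0 : ℤ) < T := by exact_mod_cast hT
  have hmod : ∀ i, (x + (T : ℤ) • fun j => -(x j / T)) i = x i % T := fun i => by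
    rw [Pi.add_apply, Pi.smul_apply, smul_eq_mul, mul_neg, ← sub_eq_add_neg, Int.emod_def]
  refine ⟨fun i => -(x i / T), fun i => ?_, fun i => ?_⟩
  · exact (Int.emod_nonneg (x i) hT'.ne').trans_eq (hmod i).symm
  · exact (hmod i).trans_le (Int.emod_lt_of_pos (x i) hT').le

lemma IsPeriodic.finite_range (hT : 0 < T) (hh : IsPeriodic T h) : (Set.range h).Finite := by
  refine ((Set.finite_Icc (0 : Fin N → ℤ) (fun _ => (T : ℤ))).image h).subset ?_
  rintro _ ⟨x, rfl⟩
  obtain ⟨k, hk⟩ := exists_add_smul_mem_Icc hT x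
  exact ⟨_, hk, hh.periodic_smul k x⟩

end Periodic

section Shift

variable {N : ℕ} {p : ℝ} {V u : (Fin N → ℤ) → ℝ} {f : (Fin N → ℤ) → ℝ → ℝ} {z : Fin N → ℤ}

lemma tsum_comp_shift {h : (Fin N → ℤ) → ℝ → ℝ} (hh : Function.Periodic h z)
    (u : (Fin N → ℤ) → ℝ) : ∑' x, h x (u (x + z)) = ∑' x, h x (u x) := by
  rw [← (Equiv.addRight z).tsum_eq fun x => h x (u x)]
  simp only [Equiv.coe_addRight, hh _]

lemma energy_shift (hV : Function.Periodic V z) (hf : Function.Periodic f z)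
    (hu : HasFiniteEnergy p V u) : energy p V f (fun x => u (x + z)) = energy p V f u := by
  rw [energy, energy, normPow_shift hu hV,
    tsum_comp_shift (h := primitive f) (fun x => by ext t; simp only [primitive, hf x])]

lemma nehariFn_shift (hV : Function.Periodic V z) (hf : Function.Periodic f z)
    (hu : HasFiniteEnergy p V u) : nehariFn p V f (fun x => u (x + z)) = nehariFn p V f u := by
  rw [nehariFn, nehariFn, normPow_shift hu hV,
    tsum_comp_shift (h := fun x t => f x t * t) (fun x => by ext t; simp only [hf x])]

lemma Admissible.shift_mem_nehari (A : Admissible p V f) (hV : Function.Periodic V z)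
    (hf : Function.Periodic f z) (hu : u ∈ nehari p V f) :
    (fun x => u (x + z)) ∈ nehari p V f := by
  obtain ⟨hE, h0, hn⟩ := A.mem_nehari.1 hu
  obtain ⟨x, hx⟩ := Function.ne_iff.1 h0
  exact A.mem_nehari.2 ⟨hE.shift hV, Function.ne_iff.2 ⟨x - z, by simpa using hx⟩,
    (nehariFn_shift hV hf hE).trans hn⟩

end Shift

lemma tendsto_add_sub_sub {g : ℕ → ℝ} {h : ℝ → ℝ} (hc : Continuous h) (h0 : h 0 = 0)
    (hg : Tendsto g atTop (𝓝 0)) (b : ℝ) :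
    Tendsto (fun n => h (g n + b) - h (g n) - h b) atTop (𝓝 0) := by
  have hadd := (hc.tendsto (0 + b)).comp (hg.add_const b)
  have hlim := (hadd.sub ((hc.tendsto 0).comp hg)).sub_const (h b)
  simpa [Function.comp_def, h0] using hlim

lemma ne_zero_of_tendsto {X : Type*} {s : Set X} (hs : s.Finite) {δ : ℝ} (hδ : 0 < δ)
    {v : ℕ → X → ℝ} {u : X → ℝ} (hv : ∀ n, ∃ y ∈ s, δ ≤ |v n y|)
    (ht : ∀ x, Tendsto (fun n => v n x) atTop (𝓝 (u x))) : u ≠ 0 := by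
  rintro rfl
  have hsmall : ∀ᶠ n in atTop, ∀ y ∈ s, |v n y| < δ :=
    (eventually_all_finite hs).2 fun y _ => (ht y).abs.eventually_lt_const (by simpa)
  obtain ⟨n, hn⟩ := hsmall.exists
  obtain ⟨y, hy, hle⟩ := hv n
  exact (hn y hy).not_ge hle

/-- The ground state level `inf Φ` over the Nehari manifold. -/
noncomputable def groundLevel {N : ℕ} (p : ℝ) (V : (Fin N → ℤ) → ℝ)
    (f : (Fin N → ℤ) → ℝ → ℝ) : ℝ := sInf (energy p V f '' nehari p V f)

namespace Admissible

variable {N : ℕ} {p M : ℝ} {V u : (Fin N → ℤ) → ℝ} {f : (Fin N → ℤ) → ℝ → ℝ}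
  {v w : ℕ → (Fin N → ℤ) → ℝ}

section Bounds

lemma primitive_lt_normPow (A : Admissible p V f) (hu : u ∈ nehari p V f) (x : Fin N → ℤ) :
    primitive f x (u x) < normPow p V u := by
  obtain ⟨h, h0, -⟩ := A.mem_nehari.1 hu
  have hn := normPow_pos A.one_lt A.lt_dim A.nonneg h h0
  calc primitive f x (u x) ≤ f x (u x) * u x / p := (A.isSuperlinear x).integral_le A.pos _
    _ ≤ (∑' y, f y (u y) * u y) / p := by
      have := A.pos
      gcongr
      exact (A.summable_mul_self h).le_tsum x fun y _ => (A.isSuperlinear y).mul_self_nonneg _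
    _ = normPow p V u / p := by rw [A.normPow_eq_tsum hu]
    _ < normPow p V u := div_lt_self hn A.one_lt

lemma exists_normPow_le_of_le_abs (A : Admissible p V f) {κ : ℝ} (hκ : 0 < κ) :
    ∃ M, ∀ u ∈ nehari p V f, ∀ x, κ * normPow p V u ^ (1 / p) ≤ |u x| → normPow p V u ≤ M := by
  obtain ⟨R, hR, hsup⟩ := A.superlinear (1 / κ ^ p)
  refine ⟨(R / κ) ^ p, fun u hu x hx => ?_⟩
  have hp := A.pos
  have hn := normPow_nonneg (p := p) A.nonneg u
  have hroot : (normPow p V u ^ (1 / p)) ^ p = normPow p V u := by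
    rw [one_div, Real.rpow_inv_rpow hn hp.ne']
  have hxp : κ ^ p * normPow p V u ≤ |u x| ^ p := by
    rw [← hroot, ← Real.mul_rpow hκ.le (by positivity)]
    gcongr
  have hxR : |u x| ≤ R := by
    by_contra! hlt
    have hbig := hsup x (u x) hlt
    have hux : 0 < |u x| := hR.trans hlt
    rw [div_le_div_iff₀ (by positivity) (by positivity), one_mul] at hbig
    have : primitive f x (u x) * κ ^ p < normPow p V u * κ ^ p := by
      gcongr
      exact A.primitive_lt_normPow hu x
    linarith
  rw [Real.div_rpow hR.le hκ.le, le_div_iff₀' (by positivity)]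
  exact hxp.trans (by gcongr)

lemma exists_lt_energy_smul (A : Admissible p V f) (a : ℝ) :
    ∃ s > (0 : ℝ), ∃ κ > 0, ∀ v, HasFiniteEnergy p V v → normPow p V v = 1 → (∀ x, |v x| < κ) →
      a < energy p V f (s • v) := by
  obtain ⟨C, hC⟩ := A.exists_tsum_rpow_le 1
  have hp := A.pos
  set s : ℝ := (p * (|a| + 2)) ^ (1 / p)
  have hs : 0 < s := by positivity
  have hsp : s ^ p = p * (|a| + 2) := by
    simp only [s, one_div]
    rw [Real.rpow_inv_rpow (by positivity) hp.ne']
  obtain ⟨δ, hδ, hsmall⟩ :=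
    A.exists_abs_mul_self_le (ε := 1 / (s ^ pStar N p * (|C| + 1))) (by positivity)
  refine ⟨s, hs, δ / s, by positivity, fun v hv hv1 hlt => ?_⟩
  have hterm : ∀ x, primitive f x ((s • v) x) ≤ 1 / (|C| + 1) * |v x| ^ pStar N p := fun x => by
    have hsx : |(s • v) x| = s * |v x| := by simp [abs_mul, abs_of_pos hs]
    calc primitive f x ((s • v) x) ≤ f x ((s • v) x) * (s • v) x / p :=
          (A.isSuperlinear x).integral_le hp _
      _ ≤ f x ((s • v) x) * (s • v) x :=
          div_le_self ((A.isSuperlinear x).mul_self_nonneg _) A.one_lt.le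
      _ ≤ 1 / (s ^ pStar N p * (|C| + 1)) * |(s • v) x| ^ pStar N p :=
          (le_abs_self _).trans (hsmall x _ (by rw [hsx]; exact (lt_div_iff₀' hs).1 (hlt x)))
      _ = 1 / (|C| + 1) * |v x| ^ pStar N p := by
          rw [hsx, Real.mul_rpow hs.le (abs_nonneg _)]
          field_simp
  have hsum : ∑' x, primitive f x ((s • v) x) ≤ 1 := by
    calc _ ≤ ∑' x, 1 / (|C| + 1) * |v x| ^ pStar N p :=
          (A.summable_primitive (hv.smul s)).tsum_le_tsum hterm ((A.summable_rpow hv).mul_left _)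
      _ ≤ 1 / (|C| + 1) * (|C| + 1) := by
          rw [tsum_mul_left]
          gcongr
          linarith [hC v hv hv1.le, le_abs_self C]
      _ = 1 := by field_simp
  have hmain : 1 / p * normPow p V (s • v) = |a| + 2 := by
    rw [normPow_smul, hv1, abs_of_pos hs, hsp]
    field_simp
  rw [energy, hmain]
  linarith [le_abs_self a]

/-- Either the normalized function is nowhere large, and then a fixed multiple of it has large
energy, or it is large somewhere, and then superlinearity bounds the norm. -/
lemma exists_normPow_le_of_energy_le (A : Admissible p V f) (a : ℝ) :
    ∃ M, ∀ u ∈ nehari p V f, energy p V f u ≤ a → normPow p V u ≤ M := by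
  obtain ⟨s, hs, κ, hκ, hlarge⟩ := A.exists_lt_energy_smul a
  obtain ⟨M, hM⟩ := A.exists_normPow_le_of_le_abs hκ
  refine ⟨M, fun u hu hua => ?_⟩
  obtain ⟨h, h0, -⟩ := A.mem_nehari.1 hu
  have hn := normPow_pos A.one_lt A.lt_dim A.nonneg h h0
  set n := normPow p V u ^ (1 / p) with hndef
  have hn0 : 0 < n := by positivity
  have hnp : n ^ p = normPow p V u := by rw [hndef, one_div, Real.rpow_inv_rpow hn.le A.pos.ne']
  have hnorm : normPow p V (n⁻¹ • u) = 1 := by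
    rw [normPow_smul, abs_of_pos (by positivity), Real.inv_rpow hn0.le, hnp, inv_mul_cancel₀ hn.ne']
  by_contra! hMu
  refine (hlarge (n⁻¹ • u) (h.smul _) hnorm fun x => ?_).not_ge ?_
  · have hx : |u x| < κ * n := not_le.1 fun hle => (hM u hu x hle).not_gt hMu
    rw [Pi.smul_apply, smul_eq_mul, abs_mul, abs_of_pos (inv_pos.2 hn0)]
    rwa [inv_mul_lt_iff₀' hn0]
  · rw [smul_smul]
    exact (A.energy_smul_le hu (by positivity)).trans hua

lemma exists_le_abs_of_normPow_le (A : Admissible p V f) (M : ℝ) :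
    ∃ δ > 0, ∀ u ∈ nehari p V f, normPow p V u ≤ M → ∃ x, δ ≤ |u x| := by
  obtain ⟨K, hK, hS⟩ := exists_tsum_abs_rpow_pStar_le_normPow A.one_lt A.lt_dim A.nonneg
  have hr : 0 < pStar N p / p - 1 := sub_pos.2 ((one_lt_div A.pos).2 A.lt_pStar)
  set L := max M 0 ^ (pStar N p / p - 1)
  have hL : 0 < L + 1 := by positivity
  obtain ⟨δ, hδ, hsmall⟩ := A.exists_abs_mul_self_le (ε := 1 / (2 * (K * (L + 1)))) (by positivity)
  refine ⟨δ, hδ, fun u hu hM => ?_⟩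
  by_contra! hcon
  obtain ⟨h, h0, -⟩ := A.mem_nehari.1 hu
  have hn := normPow_pos A.one_lt A.lt_dim A.nonneg h h0
  have hpow : normPow p V u ^ (pStar N p / p) ≤ (L + 1) * normPow p V u := by
    rw [← sub_add_cancel (pStar N p / p) 1, Real.rpow_add_one hn.ne']
    gcongr
    have : normPow p V u ^ (pStar N p / p - 1) ≤ L := by
      simp only [L]
      gcongr
      exact hM.trans (le_max_left _ _)
    linarith
  have hhalf : normPow p V u ≤ normPow p V u / 2 := by
    calc normPow p V u = ∑' x, f x (u x) * u x := A.normPow_eq_tsum hu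
      _ ≤ ∑' x, 1 / (2 * (K * (L + 1))) * |u x| ^ pStar N p :=
          (A.summable_mul_self h).tsum_le_tsum
            (fun x => (le_abs_self _).trans (hsmall x _ (hcon x))) ((A.summable_rpow h).mul_left _)
      _ ≤ 1 / (2 * (K * (L + 1))) * (K * ((L + 1) * normPow p V u)) := by
          rw [tsum_mul_left]
          gcongr
          exact (hS u h).2.trans (by gcongr)
      _ = normPow p V u / 2 := by field_simp
  linarith

end Bounds

section Splitting

lemma tendsto_normPow_split (A : Admissible p V f) (hw : ∀ n, HasFiniteEnergy p V (w n))
    (hu : HasFiniteEnergy p V u) (hM : ∀ n, normPow p V (w n) ≤ M)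
    (ht : ∀ x, Tendsto (fun n => w n x) atTop (𝓝 0)) :
    Tendsto (fun n => normPow p V (w n + u) - normPow p V (w n) - normPow p V u) atTop (𝓝 0) := by
  have hp := A.pos
  have hgrad : ∀ c, Tendsto (fun n => grad (w n) c) atTop (𝓝 0) := by
    rintro (d | x)
    · simpa using (ht d.snd).sub (ht d.fst)
    · exact ht x
  have hsum := fun n => ((hw n).add hp.le A.nonneg hu).summable_density
  have key := tendsto_tsum_of_abs_le_mul_add (K := M)
    (D := fun n c => density p V (w n + u) c - density p V (w n) c - density p V u c)
    (fun n => density_nonneg A.nonneg (w n)) (fun n => (hw n).summable_density)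
    (fun n => (normPow_eq_tsum_density (hw n).summable_density).symm.trans_le (hM n))
    hu.summable_density (fun ε hε => ?_) (fun c => ?_)
  · refine key.congr fun n => ?_
    rw [((hsum n).sub (hw n).summable_density).tsum_sub hu.summable_density,
      (hsum n).tsum_sub (hw n).summable_density, normPow_eq_tsum_density (hsum n),
      normPow_eq_tsum_density (hw n).summable_density, normPow_eq_tsum_density hu.summable_density]
  · obtain ⟨C, hC⟩ := exists_abs_rpow_split_le hp.le hε
    refine ⟨C, fun n c => ?_⟩
    have hwt := weight_nonneg A.nonneg c
    simp only [density, map_add, Pi.add_apply]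
    rw [← mul_sub, ← mul_sub, abs_mul, abs_of_nonneg hwt]
    calc _ ≤ weight V c * (ε * |grad (w n) c| ^ p + C * |grad u c| ^ p) :=
          mul_le_mul_of_nonneg_left (hC _ _) hwt
      _ = _ := by ring
  · have hpow : Continuous fun t : ℝ => weight V c * |t| ^ p :=
      continuous_const.mul (continuous_abs.rpow_const fun _ => Or.inr hp.le)
    simpa [density] using
      tendsto_add_sub_sub hpow (by simp [Real.zero_rpow hp.ne']) (hgrad c) (grad u c)

lemma tendsto_tsum_split (A : Admissible p V f) {h : (Fin N → ℤ) → ℝ → ℝ}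
    (hh : IsUniformlyLittleO (pStar N p) h) (hw : ∀ n, HasFiniteEnergy p V (w n))
    (hu : HasFiniteEnergy p V u) (hM : ∀ n, normPow p V (w n) ≤ M)
    (ht : ∀ x, Tendsto (fun n => w n x) atTop (𝓝 0)) :
    Tendsto (fun n => ∑' x, h x ((w n + u) x) - ∑' x, h x (w n x) - ∑' x, h x (u x))
      atTop (𝓝 0) := by
  obtain ⟨B₁, hB₁0, hB₁⟩ := A.exists_abs_le M
  obtain ⟨B₂, -, hB₂⟩ := A.exists_abs_le (normPow p V u)
  obtain ⟨K, hK⟩ := A.exists_tsum_rpow_le M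
  have hsum := fun n => A.summable_comp hh ((hw n).add A.pos.le A.nonneg hu)
  have hsumw := fun n => A.summable_comp hh (hw n)
  have hsumu := A.summable_comp hh hu
  have key := tendsto_tsum_of_abs_le_mul_add (K := K)
    (D := fun n x => h x ((w n + u) x) - h x (w n x) - h x (u x))
    (φ := fun n x => |w n x| ^ pStar N p)
    (fun _ _ => by positivity) (fun n => A.summable_rpow (hw n)) (fun n => hK _ (hw n) (hM n))
    (A.summable_rpow hu) (fun ε hε => ?_) (fun x => ?_)
  · refine key.congr fun n => ?_
    rw [((hsum n).sub (hsumw n)).tsum_sub hsumu, (hsum n).tsum_sub (hsumw n)]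
  · obtain ⟨C, hC⟩ := hh.exists_abs_split_le A.pStar_pos.le (hB₁0.trans (le_max_left B₁ B₂)) hε
    exact ⟨C, fun n x => hC x _ _ ((hB₁ _ (hw n) (hM n) x).trans (le_max_left _ _))
      ((hB₂ u hu le_rfl x).trans (le_max_right _ _))⟩
  · exact tendsto_add_sub_sub (hh.continuous x) (hh.map_zero A.pStar_pos x) (ht x) (u x)

end Splitting

section Existence

lemma energy_nonneg (A : Admissible p V f) (hu : u ∈ nehari p V f) : 0 ≤ energy p V f u := by
  rw [A.energy_eq_tsum_gap hu]
  exact tsum_nonneg fun x => (A.isSuperlinear x).gap_nonneg A.pos _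

lemma bddBelow_energy (A : Admissible p V f) : BddBelow (energy p V f '' nehari p V f) :=
  ⟨0, Set.forall_mem_image.2 fun _ => A.energy_nonneg⟩

lemma groundLevel_le (A : Admissible p V f) (hu : u ∈ nehari p V f) :
    groundLevel p V f ≤ energy p V f u := csInf_le A.bddBelow_energy ⟨u, hu, rfl⟩

lemma nehari_nonempty (A : Admissible p V f) : (nehari p V f).Nonempty := by
  have hfin : (Function.support (Pi.single 0 1 : (Fin N → ℤ) → ℝ)).Finite :=
    (Set.finite_singleton 0).subset Pi.support_single_subset
  obtain ⟨t, -, ht⟩ :=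
    A.exists_smul_mem_nehari (.of_finite_support A.pos.ne' hfin) (by simp)
  exact ⟨_, ht⟩

lemma nehariFn_zero (A : Admissible p V f) : nehariFn p V f 0 = 0 := by
  simp [nehariFn, normPow, Real.zero_rpow A.pos.ne']

lemma exists_energy_smul_le_tsum_gap (A : Admissible p V f) (hu : HasFiniteEnergy p V u)
    (h0 : u ≠ 0) (hn : nehariFn p V f u ≤ 0) :
    ∃ t : ℝ, t • u ∈ nehari p V f ∧ energy p V f (t • u) ≤ ∑' x, gap p (f x) (u x) := by
  obtain ⟨t, ht0, ht1, ht⟩ := A.exists_smul_mem_nehari_of_nonpos hu h0 hn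
  refine ⟨t, ht, ?_⟩
  rw [A.energy_eq_tsum_gap ht]
  exact (A.summable_gap (hu.smul t)).tsum_le_tsum
    (fun x => (A.isSuperlinear x).gap_mul_le A.pos _ ht0 ht1) (A.summable_gap hu)

lemma exists_tendsto_subseq (A : Admissible p V f) (hv : ∀ n, HasFiniteEnergy p V (v n))
    (hM : ∀ n, normPow p V (v n) ≤ M) :
    ∃ u, HasFiniteEnergy p V u ∧ ∃ φ : ℕ → ℕ, StrictMono φ ∧
      ∀ x, Tendsto (fun n => v (φ n) x) atTop (𝓝 (u x)) := by
  obtain ⟨B, -, hB⟩ := A.exists_abs_le M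
  have hcomp : IsCompact (Set.univ.pi fun _ : Fin N → ℤ => Set.Icc (-B) B) :=
    isCompact_univ_pi fun _ => isCompact_Icc
  obtain ⟨u, -, φ, hφ, hlim⟩ := hcomp.tendsto_subseq (x := v) fun n x _ =>
    abs_le.1 (hB _ (hv n) (hM n) x)
  have hlim' := tendsto_pi_nhds.1 hlim
  exact ⟨u, .of_tendsto A.one_lt A.lt_dim A.nonneg (fun n => hv (φ n))
    (.of_forall fun n => hM (φ n)) hlim', φ, hφ, hlim'⟩

lemma exists_translate_le_abs (A : Admissible p V f) {T : ℕ} (hT : 0 < T) (hV : IsPeriodic T V)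
    (hf : IsPeriodic T f) (M : ℝ) :
    ∃ δ > 0, ∀ u ∈ nehari p V f, normPow p V u ≤ M → ∃ v ∈ nehari p V f,
      energy p V f v = energy p V f u ∧ normPow p V v ≤ M ∧
      ∃ y ∈ Set.Icc (0 : Fin N → ℤ) (fun _ => (T : ℤ)), δ ≤ |v y| := by
  obtain ⟨δ, hδ, hlow⟩ := A.exists_le_abs_of_normPow_le M
  refine ⟨δ, hδ, fun u hu hM => ?_⟩
  obtain ⟨x, hx⟩ := hlow u hu hM
  obtain ⟨k, hk⟩ := exists_add_smul_mem_Icc hT x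
  have hE := (A.mem_nehari.1 hu).1
  have hVk := hV.periodic_smul (-k)
  have hfk := hf.periodic_smul (-k)
  refine ⟨_, A.shift_mem_nehari hVk hfk hu, energy_shift hVk hfk hE,
    (normPow_shift hE hVk).trans_le hM, _, hk, ?_⟩
  simpa using hx

lemma exists_minimizing_seq (A : Admissible p V f) {T : ℕ} (hT : 0 < T) (hV : IsPeriodic T V)
    (hf : IsPeriodic T f) :
    ∃ (v : ℕ → (Fin N → ℤ) → ℝ) (u : (Fin N → ℤ) → ℝ) (M : ℝ), (∀ n, v n ∈ nehari p V f) ∧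
      (∀ n, normPow p V (v n) ≤ M) ∧
      Tendsto (fun n => energy p V f (v n)) atTop (𝓝 (groundLevel p V f)) ∧
      HasFiniteEnergy p V u ∧ u ≠ 0 ∧ ∀ x, Tendsto (fun n => v n x) atTop (𝓝 (u x)) := by
  obtain ⟨e, hanti, he, hmem⟩ :=
    exists_seq_tendsto_sInf (A.nehari_nonempty.image _) A.bddBelow_energy
  choose u₁ hu₁ hu₁e using hmem
  obtain ⟨M, hM⟩ := A.exists_normPow_le_of_energy_le (e 0)
  obtain ⟨δ, hδ, htrans⟩ := A.exists_translate_le_abs hT hV hf M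
  choose v hv hve hvM hvδ using fun n =>
    htrans (u₁ n) (hu₁ n) (hM _ (hu₁ n) (by rw [hu₁e]; exact hanti (Nat.zero_le n)))
  obtain ⟨u, hu, φ, hφ, ht⟩ :=
    A.exists_tendsto_subseq (fun n => (A.mem_nehari.1 (hv n)).1) hvM
  refine ⟨v ∘ φ, u, M, fun n => hv _, fun n => hvM _, ?_, hu,
    ne_zero_of_tendsto (Set.finite_Icc _ _) hδ (fun n => hvδ (φ n)) ht, ht⟩
  simpa [Function.comp_def, hve, hu₁e, groundLevel] using he.comp hφ.tendsto_atTop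

lemma tsum_gap_le_of_tendsto (A : Admissible p V f) (hv : ∀ n, v n ∈ nehari p V f) {c : ℝ}
    (hc : Tendsto (fun n => energy p V f (v n)) atTop (𝓝 c))
    (ht : ∀ x, Tendsto (fun n => v n x) atTop (𝓝 (u x))) : ∑' x, gap p (f x) (u x) ≤ c := by
  refine le_of_forall_pos_le_add fun ε hε => ?_
  refine (summable_and_tsum_le_of_tendsto (g := fun n x => gap p (f x) (v n x))
    (fun n x => (A.isSuperlinear x).gap_nonneg A.pos _)
    (fun n => A.summable_gap (A.mem_nehari.1 (hv n)).1) ?_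
    (fun x => ((A.isSuperlinear x).continuous_gap.tendsto _).comp (ht x))).2
  filter_upwards [hc.eventually_lt_const (lt_add_of_pos_right c hε)] with n hn
  exact (A.energy_eq_tsum_gap (hv n)).symm.trans_le hn.le

/-- If the Nehari functional of the limit were positive, the remainders `v n - u` would have
negative Nehari functional but, by the Brezis–Lieb splitting, energy below the ground level. -/
lemma nehariFn_nonpos_of_tendsto (A : Admissible p V f) (hv : ∀ n, v n ∈ nehari p V f)
    (hM : ∀ n, normPow p V (v n) ≤ M)
    (hc : Tendsto (fun n => energy p V f (v n)) atTop (𝓝 (groundLevel p V f)))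
    (hu : HasFiniteEnergy p V u) (h0 : u ≠ 0)
    (ht : ∀ x, Tendsto (fun n => v n x) atTop (𝓝 (u x))) : nehariFn p V f u ≤ 0 := by
  by_contra! hn
  have hvE := fun n => (A.mem_nehari.1 (hv n)).1
  have hwE := fun n => (hvE n).sub A.pos.le A.nonneg hu
  have hwM : ∀ n, normPow p V (v n - u) ≤ 2 ^ p * (M + normPow p V u) := fun n =>
    (normPow_sub_le A.pos.le A.nonneg (hvE n) hu).trans (by gcongr; exact hM n)
  have hw0 : ∀ x, Tendsto (fun n => (v n - u) x) atTop (𝓝 0) := fun x => by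
    simpa using (ht x).sub_const (u x)
  have snorm := A.tendsto_normPow_split hwE hu hwM hw0
  have smul := A.tendsto_tsum_split A.isUniformlyLittleO_mul_self hwE hu hwM hw0
  have sgap := A.tendsto_tsum_split A.isUniformlyLittleO_gap hwE hu hwM hw0
  simp only [sub_add_cancel] at snorm smul sgap
  have hnehari : Tendsto (fun n => nehariFn p V f (v n - u)) atTop (𝓝 (-nehariFn p V f u)) := by
    have := ((snorm.sub smul).neg).sub_const (nehariFn p V f u)
    simp only [sub_zero, neg_zero, zero_sub] at this
    refine this.congr fun n => ?_
    rw [nehariFn, nehariFn, ← A.normPow_eq_tsum (hv n)]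
    ring
  have hgap : Tendsto (fun n => ∑' x, gap p (f x) ((v n - u) x)) atTop
      (𝓝 (groundLevel p V f - ∑' x, gap p (f x) (u x))) := by
    have := (hc.sub sgap).sub_const (∑' x, gap p (f x) (u x))
    rw [sub_zero] at this
    refine this.congr fun n => ?_
    rw [A.energy_eq_tsum_gap (hv n)]
    ring
  obtain ⟨n, hn1, hn2⟩ := ((hnehari.eventually_lt_const (neg_lt_zero.2 hn)).and
    (hgap.eventually_lt_const (sub_lt_self _ (A.tsum_gap_pos hu h0)))).exists
  have hw_ne : v n - u ≠ 0 := fun h => hn1.ne (h ▸ A.nehariFn_zero)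
  obtain ⟨t, ht, hle⟩ := A.exists_energy_smul_le_tsum_gap (hwE n) hw_ne hn1.le
  exact ((A.groundLevel_le ht).trans hle).not_gt hn2

theorem exists_isGroundState (A : Admissible p V f) {T : ℕ} (hT : 0 < T) (hV : IsPeriodic T V)
    (hf : IsPeriodic T f) : ∃ u, IsGroundState p V f u := by
  obtain ⟨v, u, M, hv, hM, hc, hu, h0, ht⟩ := A.exists_minimizing_seq hT hV hf
  obtain ⟨t, htu, hle⟩ := A.exists_energy_smul_le_tsum_gap hu h0
    (A.nehariFn_nonpos_of_tendsto hv hM hc hu h0 ht)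
  exact ⟨t • u, htu, fun w hw =>
    hle.trans ((A.tsum_gap_le_of_tendsto hv hc ht).trans (A.groundLevel_le hw))⟩

end Existence

end Admissible

lemma continuous_abs_rpow_sub_two_mul {p : ℝ} (hp : 1 < p) :
    Continuous fun t : ℝ => |t| ^ (p - 2) * t := by
  have hp0 : p ≠ 0 := by positivity
  have hderiv : deriv (fun t : ℝ => |t| ^ p) = fun t => p * (|t| ^ (p - 2) * t) := by
    ext t
    rw [(hasDerivAt_abs_rpow t hp).deriv, mul_assoc]
  have hcont := (contDiff_norm_rpow (E := ℝ) hp).continuous_deriv le_rfl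
  simp only [Real.norm_eq_abs, hderiv] at hcont
  simpa [hp0] using hcont.const_mul p⁻¹

lemma tsum_eq_tsum_add_sum {X : Type*} {F G : X → ℝ} {s : Finset X} (hF : Summable F)
    (hG : Summable G) (h : ∀ x ∉ s, F x = G x) :
    ∑' x, F x = ∑' x, G x + ∑ x ∈ s, (F x - G x) := by
  rw [← sub_eq_iff_eq_add', ← hF.tsum_sub hG, tsum_eq_sum fun x hx => sub_eq_zero.2 (h x hx)]

lemma eventually_smul_add_smul_ne_zero {X : Type*} {u : X → ℝ} (h0 : u ≠ 0) (v : X → ℝ) {a : ℝ}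
    (ha : 0 < a) : ∀ᶠ s in 𝓝 (0 : ℝ), ∀ t ≥ a, t • u + s • v ≠ 0 := by
  obtain ⟨x, hx⟩ := Function.ne_iff.1 h0
  have hlim : Tendsto (fun s : ℝ => |s * v x|) (𝓝 0) (𝓝 0) := by
    simpa using ((continuous_id.mul (continuous_const (y := v x))).abs).tendsto (0 : ℝ)
  filter_upwards [hlim.eventually_lt_const (mul_pos ha (abs_pos.2 hx))] with s hs t ht hzero
  have hsx : |s * v x| = t * |u x| := by
    rw [← abs_of_nonneg (ha.le.trans ht), ← abs_mul, ← abs_neg]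
    congr 1
    linarith [show t * u x + s * v x = 0 from congrFun hzero x]
  exact (hs.trans_le (mul_le_mul_of_nonneg_right ht (abs_nonneg _))).ne hsx

section SummationByParts

variable {X : Type*} {G : SimpleGraph X} {a : G.Dart → ℝ}

lemma tsum_dart_mul_sub (ha : ∀ d, a d.symm = -a d) {v : X → ℝ}
    (hv : Summable fun d : G.Dart => a d * v d.fst) :
    ∑' d : G.Dart, 1 / 2 * (a d * (v d.snd - v d.fst)) = -∑' d : G.Dart, a d * v d.fst := by
  have hsnd : HasSum (fun d : G.Dart => a d * v d.snd) (-∑' d : G.Dart, a d * v d.fst) := by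
    have h := (Equiv.hasSum_iff
      (SimpleGraph.Dart.symm_involutive (G := G)).toPerm).2 hv.hasSum.neg
    refine h.congr_fun fun d => ?_
    simp [ha]
  refine (((hsnd.sub hv.hasSum).mul_left (1 / 2)).congr_fun fun d => ?_).tsum_eq.trans ?_
  · ring
  · ring

lemma tsum_dart_mul_single [DecidableEq X] (a : G.Dart → ℝ) (x : X) :
    ∑' d : G.Dart, a d * (Pi.single x 1 : X → ℝ) d.fst =
      ∑' y : G.neighborSet x, a (G.dartOfNeighborSet x y) := by
  rw [← (G.dartOfNeighborSet_injective x).tsum_eq]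
  · exact tsum_congr fun y => by simp [SimpleGraph.dartOfNeighborSet]
  · intro d hd
    have hx : d.fst = x := by
      by_contra hne
      simp [Pi.single_eq_of_ne hne] at hd
    subst hx
    exact ⟨⟨d.snd, d.adj⟩, rfl⟩

end SummationByParts

section EnergyDeriv

variable {N : ℕ} {p : ℝ} {V v w : (Fin N → ℤ) → ℝ} {f : (Fin N → ℤ) → ℝ → ℝ}

lemma energyDeriv_neg (p : ℝ) (V : (Fin N → ℤ) → ℝ) (f : (Fin N → ℤ) → ℝ → ℝ)
    (u v : (Fin N → ℤ) → ℝ) : energyDeriv p V f u (-v) = -energyDeriv p V f u v := by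
  have hgrad : ∀ d : (lattice N).Dart, -v d.snd - -v d.fst = -(v d.snd - v d.fst) := fun d => by
    ring
  simp only [energyDeriv, Pi.neg_apply, hgrad, mul_neg, tsum_neg]
  ring

lemma energyDeriv_eq_sum (p : ℝ) (V w : (Fin N → ℤ) → ℝ) (f : (Fin N → ℤ) → ℝ → ℝ)
    (hv : (Function.support v).Finite) :
    energyDeriv p V f w v =
      ∑ c ∈ (finite_support_grad hv).toFinset,
        weight V c * (|grad w c| ^ (p - 2) * grad w c * grad v c) -
      ∑ x ∈ hv.toFinset, f x (w x) * v x := by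
  have hcell : ∀ c ∉ (finite_support_grad hv).toFinset,
      weight V c * (|grad w c| ^ (p - 2) * grad w c * grad v c) = 0 := fun c hc => by
    simp [Function.notMem_support.1 (mt (Set.Finite.mem_toFinset _).2 hc)]
  have hsum := summable_of_ne_finset_zero (L := .unconditional _) hcell
  have hvertex : ∀ x ∉ hv.toFinset, f x (w x) * v x = 0 := fun x hx => by
    simp [Function.notMem_support.1 (mt (Set.Finite.mem_toFinset _).2 hx)]
  rw [← tsum_eq_sum (L := .unconditional _) hcell, ← tsum_eq_sum (L := .unconditional _) hvertex,
    Summable.tsum_sum (hsum.comp_injective Sum.inl_injective)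
      (hsum.comp_injective Sum.inr_injective), energyDeriv]
  simp only [weight, Sum.elim_inl, Sum.elim_inr, grad_inl, grad_inr, mul_assoc]

lemma energyDeriv_single (p : ℝ) (V u : (Fin N → ℤ) → ℝ) (f : (Fin N → ℤ) → ℝ → ℝ)
    (x : Fin N → ℤ) :
    energyDeriv p V f u (Pi.single x 1) =
      -pLaplacian p u x + V x * |u x| ^ (p - 2) * u x - f x (u x) := by
  have hsupp : (Function.support fun d : (lattice N).Dart =>
      |u d.snd - u d.fst| ^ (p - 2) * (u d.snd - u d.fst) *
        (Pi.single x 1 : (Fin N → ℤ) → ℝ) d.fst).Finite := by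
    refine (finite_setOf_fst_mem (Set.finite_singleton x)).subset fun d hd => ?_
    by_contra hne
    simp [Pi.single_eq_of_ne hne] at hd
  rw [energyDeriv, tsum_dart_mul_sub (fun d => ?_)
      (summable_of_hasFiniteSupport hsupp),
    tsum_dart_mul_single (fun d => |u d.snd - u d.fst| ^ (p - 2) * (u d.snd - u d.fst)),
    tsum_eq_single x fun y hy => by simp [hy], tsum_eq_single x fun y hy => by simp [hy],
    Pi.single_eq_same, mul_one, mul_one]
  · rfl
  · rw [← mul_neg, neg_sub, abs_sub_comm]
    rfl

lemma normPow_add_smul (hp : 0 < p) (hV : ∀ x, 0 ≤ V x) (hw : HasFiniteEnergy p V w)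
    (hv : (Function.support v).Finite) (s : ℝ) :
    normPow p V (w + s • v) = normPow p V w +
      ∑ c ∈ (finite_support_grad hv).toFinset, (density p V (w + s • v) c - density p V w c) := by
  have hws :=
    (hw.add hp.le hV ((HasFiniteEnergy.of_finite_support hp.ne' hv).smul s)).summable_density
  rw [normPow_eq_tsum_density hws, normPow_eq_tsum_density hw.summable_density]
  refine tsum_eq_tsum_add_sum hws hw.summable_density fun c hc => ?_
  simp [density, Function.notMem_support.1 (mt (Set.Finite.mem_toFinset _).2 hc)]

lemma tsum_comp_add_smul {h : (Fin N → ℤ) → ℝ → ℝ} (hv : (Function.support v).Finite) {s : ℝ}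
    (hws : Summable fun x => h x ((w + s • v) x)) (hw : Summable fun x => h x (w x)) :
    ∑' x, h x ((w + s • v) x) =
      ∑' x, h x (w x) + ∑ x ∈ hv.toFinset, (h x ((w + s • v) x) - h x (w x)) := by
  refine tsum_eq_tsum_add_sum hws hw fun x hx => ?_
  simp [Function.notMem_support.1 (mt (Set.Finite.mem_toFinset _).2 hx)]

lemma hasDerivAt_density_add_smul (hp : 1 < p) (V w v : (Fin N → ℤ) → ℝ) (c : Cell N) (s : ℝ) :
    HasDerivAt (fun s : ℝ => density p V (w + s • v) c)
      (p * (weight V c * (|grad (w + s • v) c| ^ (p - 2) * grad (w + s • v) c * grad v c))) s := by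
  have hlin : HasDerivAt (fun s : ℝ => grad (w + s • v) c) (grad v c) s := by
    simpa using ((hasDerivAt_id s).mul_const (grad v c)).const_add (grad w c)
  exact (((hasDerivAt_abs_rpow _ hp).comp s hlin).const_mul (weight V c)).congr_deriv (by ring)

lemma continuous_density_smul_add_smul (hp : 0 ≤ p) (V u v : (Fin N → ℤ) → ℝ) (c : Cell N) :
    Continuous fun z : ℝ × ℝ => density p V (z.1 • u + z.2 • v) c :=
  continuous_iff_continuousAt.2 fun _ => tendsto_density hp (fun _ => Continuous.tendsto
    ((continuous_fst.mul continuous_const).add (continuous_snd.mul continuous_const)) _) c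

end EnergyDeriv

namespace Admissible

variable {N : ℕ} {p : ℝ} {V u v w : (Fin N → ℤ) → ℝ} {f : (Fin N → ℤ) → ℝ → ℝ}

section EulerLagrange

lemma hasFiniteEnergy_add_smul (A : Admissible p V f) (hw : HasFiniteEnergy p V w)
    (hv : (Function.support v).Finite) (s : ℝ) : HasFiniteEnergy p V (w + s • v) :=
  hw.add A.pos.le A.nonneg ((HasFiniteEnergy.of_finite_support A.pos.ne' hv).smul s)

lemma hasDerivAt_energy_add_smul (A : Admissible p V f) (hw : HasFiniteEnergy p V w)
    (hv : (Function.support v).Finite) (s : ℝ) :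
    HasDerivAt (fun s : ℝ => energy p V f (w + s • v)) (energyDeriv p V f (w + s • v) v) s := by
  have henergy : ∀ s : ℝ, energy p V f (w + s • v) =
      1 / p * (normPow p V w + ∑ c ∈ (finite_support_grad hv).toFinset,
        (density p V (w + s • v) c - density p V w c)) -
      (∑' x, primitive f x (w x) +
        ∑ x ∈ hv.toFinset, (primitive f x ((w + s • v) x) - primitive f x (w x))) := fun s => by
    rw [energy, normPow_add_smul A.pos A.nonneg hw hv, tsum_comp_add_smul hv
      (A.summable_primitive (A.hasFiniteEnergy_add_smul hw hv s)) (A.summable_primitive hw)]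
  have hdensity := HasDerivAt.fun_sum fun c (_ : c ∈ (finite_support_grad hv).toFinset) =>
    (hasDerivAt_density_add_smul A.one_lt V w v c s).sub_const (density p V w c)
  have hprimitive := HasDerivAt.fun_sum fun x (_ : x ∈ hv.toFinset) =>
    (((A.continuous x).integral_hasStrictDerivAt 0 ((w + s • v) x)).hasDerivAt.comp s
      (((hasDerivAt_id s).mul_const (v x)).const_add (w x))).sub_const (primitive f x (w x))
  refine ((((hdensity.const_add (normPow p V w)).const_mul (1 / p)).sub
    (hprimitive.const_add (∑' x, primitive f x (w x)))).congr_of_eventuallyEq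
      (.of_forall henergy)).congr_deriv ?_
  rw [energyDeriv_eq_sum p V _ f hv, ← Finset.mul_sum, one_div, inv_mul_cancel_left₀ A.pos.ne']
  simp only [one_mul]

lemma continuous_energyDeriv_smul_add_smul (A : Admissible p V f) (u : (Fin N → ℤ) → ℝ)
    (hv : (Function.support v).Finite) :
    Continuous fun z : ℝ × ℝ => energyDeriv p V f (z.1 • u + z.2 • v) v := by
  simp only [energyDeriv_eq_sum p V _ f hv]
  refine (continuous_finsetSum _ fun c _ => continuous_const.mul (.mul ?_ continuous_const)).sub
    (continuous_finsetSum _ fun x _ => .mul ((A.continuous x).comp ?_) continuous_const)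
  · have hgrad : Continuous fun z : ℝ × ℝ => grad (z.1 • u + z.2 • v) c := by
      simp only [map_add, map_smul, Pi.add_apply, Pi.smul_apply]
      fun_prop
    exact (continuous_abs_rpow_sub_two_mul A.one_lt).comp hgrad
  · simp only [Pi.add_apply, Pi.smul_apply]
    fun_prop

lemma exists_energy_add_smul_lt (A : Admissible p V f) (hu : HasFiniteEnergy p V u)
    (hv : (Function.support v).Finite) (h : energyDeriv p V f u v < 0) :
    ∃ η > 0, ∀ t s : ℝ, |t - 1| ≤ η → 0 < s → s ≤ η →
      energy p V f (t • u + s • v) < energy p V f (t • u) := by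
  have hneg : ∀ᶠ z in 𝓝 ((1 : ℝ), (0 : ℝ)), energyDeriv p V f (z.1 • u + z.2 • v) v < 0 :=
    ((A.continuous_energyDeriv_smul_add_smul u hv).tendsto _).eventually_lt_const (by simpa)
  obtain ⟨r, hr, hball⟩ := Metric.eventually_nhds_iff.1 hneg
  refine ⟨r / 2, half_pos hr, fun t s ht hs hsr => ?_⟩
  have hderiv := A.hasDerivAt_energy_add_smul (hu.smul t) hv
  have hanti : StrictAntiOn (fun s : ℝ => energy p V f (t • u + s • v)) (Set.Icc 0 s) := by
    refine strictAntiOn_of_deriv_neg (convex_Icc 0 s)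
      (fun σ _ => (hderiv σ).continuousAt.continuousWithinAt) fun σ hσ => ?_
    rw [interior_Icc] at hσ
    rw [(hderiv σ).deriv]
    refine hball (y := (t, σ)) ?_
    rw [Prod.dist_eq, max_lt_iff, Real.dist_eq, Real.dist_eq, sub_zero, abs_of_pos hσ.1]
    exact ⟨by linarith, by linarith [hσ.2]⟩
  simpa using hanti (Set.left_mem_Icc.2 hs.le) (Set.right_mem_Icc.2 hs.le) hs

/-- The change of the Nehari functional is a finite sum, hence jointly continuous. -/
lemma exists_continuous_nehariFn_add_smul (A : Admissible p V f) (hu : HasFiniteEnergy p V u)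
    (hv : (Function.support v).Finite) :
    ∃ Q : ℝ × ℝ → ℝ, Continuous Q ∧ (∀ t, Q (t, 0) = 0) ∧
      ∀ t s, nehariFn p V f (t • u + s • v) = nehariFn p V f (t • u) + Q (t, s) := by
  refine ⟨fun z => ∑ c ∈ (finite_support_grad hv).toFinset,
      (density p V (z.1 • u + z.2 • v) c - density p V (z.1 • u) c) -
    ∑ x ∈ hv.toFinset, (f x ((z.1 • u + z.2 • v) x) * (z.1 • u + z.2 • v) x -
      f x ((z.1 • u) x) * (z.1 • u) x), ?_, fun t => by simp, fun t s => ?_⟩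
  · refine (continuous_finsetSum _ fun c _ => .sub ?_ ?_).sub
      (continuous_finsetSum _ fun x _ => .sub ?_ ?_)
    · exact continuous_density_smul_add_smul A.pos.le V u v c
    · simpa [Function.comp_def] using
        (continuous_density_smul_add_smul A.pos.le V u v c).comp
          (continuous_fst.prodMk (continuous_const (y := (0 : ℝ))))
    all_goals
      have := A.continuous x
      simp only [Pi.add_apply, Pi.smul_apply]
      fun_prop
  · have hts := A.hasFiniteEnergy_add_smul (hu.smul t) hv s
    rw [nehariFn, nehariFn, normPow_add_smul A.pos A.nonneg (hu.smul t) hv,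
      tsum_comp_add_smul (h := fun x t => f x t * t) hv (A.summable_mul_self hts)
        (A.summable_mul_self (hu.smul t))]
    ring

/-- The Nehari functional changes sign along `t ↦ t • u` at `t = 1`, and still does so after a
small perturbation. -/
lemma eventually_exists_smul_add_smul_mem_nehari (A : Admissible p V f) (hu : u ∈ nehari p V f)
    (hv : (Function.support v).Finite) {η : ℝ} (hη0 : 0 < η) (hη1 : η < 1) :
    ∀ᶠ s in 𝓝 (0 : ℝ), ∃ t : ℝ, 0 ≤ t ∧ |t - 1| ≤ η ∧ t • u + s • v ∈ nehari p V f := by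
  obtain ⟨hE, h0, -⟩ := A.mem_nehari.1 hu
  obtain ⟨Q, hQ, hQ0, hnehari⟩ := A.exists_continuous_nehariFn_add_smul hE hv
  have hlim : ∀ t : ℝ, Tendsto (fun s : ℝ => nehariFn p V f (t • u + s • v)) (𝓝 0)
      (𝓝 (nehariFn p V f (t • u))) := fun t => by
    simpa [hnehari, hQ0, Function.comp_def] using
      ((hQ.comp (Continuous.prodMk_right t)).tendsto 0).const_add (nehariFn p V f (t • u))
  filter_upwards [eventually_smul_add_smul_ne_zero h0 v (sub_pos.2 hη1),
    (hlim (1 - η)).eventually_const_lt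
      (A.nehariFn_smul_pos hu (sub_pos.2 hη1) (sub_lt_self 1 hη0)),
    (hlim (1 + η)).eventually_lt_const (A.nehariFn_smul_neg hu (lt_add_of_pos_right 1 hη0))]
    with s hne hpos hneg
  have hcont : ContinuousOn (fun t : ℝ => nehariFn p V f (t • u + s • v))
      (Set.Icc (1 - η) (1 + η)) := by
    simp only [hnehari]
    exact ((A.continuousOn_nehariFn_smul hE (1 + η)).mono
      (Set.Icc_subset_Icc_left (sub_nonneg.2 hη1.le))).add
      (hQ.comp (Continuous.prodMk_left s)).continuousOn
  obtain ⟨t, ht, hts⟩ := intermediate_value_Icc' (by linarith) hcont ⟨hneg.le, hpos.le⟩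
  exact ⟨t, (sub_nonneg.2 hη1.le).trans ht.1, abs_le.2 ⟨by linarith [ht.1], by linarith [ht.2]⟩,
    A.mem_nehari.2 ⟨A.hasFiniteEnergy_add_smul (hE.smul t) hv s, hne t ht.1, hts⟩⟩

lemma energyDeriv_nonneg_of_isGroundState (A : Admissible p V f) (hu : IsGroundState p V f u)
    (hv : (Function.support v).Finite) : 0 ≤ energyDeriv p V f u v := by
  by_contra! hneg
  obtain ⟨η, hη, hlt⟩ := A.exists_energy_add_smul_lt (A.mem_nehari.1 hu.1).1 hv hneg
  have hη' : 0 < min η (1 / 2) := lt_min hη one_half_pos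
  have hsmall : ∀ᶠ s in 𝓝[>] (0 : ℝ), s ≤ η :=
    (eventually_le_nhds hη).filter_mono nhdsWithin_le_nhds
  have hmem := (A.eventually_exists_smul_add_smul_mem_nehari hu.1 hv hη'
    ((min_le_right _ _).trans_lt one_half_lt_one)).filter_mono (nhdsWithin_le_nhds (s := Set.Ioi 0))
  obtain ⟨s, ⟨hs, t, ht, ht1, hts⟩, hs0⟩ := ((hsmall.and hmem).and self_mem_nhdsWithin).exists
  exact (hu.2 _ hts).not_gt ((hlt t s (ht1.trans (min_le_left _ _)) hs0 hs).trans_le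
    (A.energy_smul_le hu.1 ht))

lemma energyDeriv_eq_zero_of_isGroundState (A : Admissible p V f) (hu : IsGroundState p V f u)
    (hv : (Function.support v).Finite) : energyDeriv p V f u v = 0 := by
  have hneg := A.energyDeriv_nonneg_of_isGroundState hu (v := -v) (by simpa using hv)
  rw [energyDeriv_neg] at hneg
  exact le_antisymm (neg_nonneg.1 hneg) (A.energyDeriv_nonneg_of_isGroundState hu hv)

theorem isSolution_of_isGroundState (A : Admissible p V f) (hu : IsGroundState p V f u) :
    IsSolution p V f u := by
  refine ⟨hu.1.1, fun x => ?_⟩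
  rw [← sub_eq_zero, ← energyDeriv_single]
  exact A.energyDeriv_eq_zero_of_isGroundState hu
    ((Set.finite_singleton x).subset Pi.support_single_subset)

end EulerLagrange

end Admissible

section Connected

variable {N : ℕ} {P : (Fin N → ℤ) → Prop}

lemma forall_of_adj (h : ∀ x y, (lattice N).Adj x y → P x → P y) {x₀ : Fin N → ℤ} (hx₀ : P x₀)
    (x : Fin N → ℤ) : P x := by
  have hper : IsPeriodic 1 P := fun x i => propext
    ⟨h _ _ (coordDart i x).adj.symm, h _ _ (coordDart i x).adj⟩
  have hx := hper.periodic_smul (x - x₀) x₀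
  rw [Nat.cast_one, one_smul, add_sub_cancel] at hx
  exact hx ▸ hx₀

end Connected

section Sign

variable {N : ℕ} {p : ℝ} {V u : (Fin N → ℤ) → ℝ} {f : (Fin N → ℤ) → ℝ → ℝ}

lemma eq_zero_of_pLaplacian_eq_zero (hu : 0 ≤ u) {x y : Fin N → ℤ} (hx : u x = 0)
    (h : pLaplacian p u x = 0) (hxy : (lattice N).Adj x y) : u y = 0 := by
  have := (neighborSet_finite x).to_subtype
  simp only [pLaplacian, hx, sub_zero, abs_of_nonneg (hu _)] at h
  have hzero := (hasSum_zero_iff_of_nonneg fun z : (lattice N).neighborSet x =>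
    mul_nonneg (Real.rpow_nonneg (hu z) (p - 2)) (hu z)).1 (h ▸ Summable.of_finite.hasSum)
  by_contra hne
  have hy : 0 < u y := (hu y).lt_of_ne' hne
  exact (mul_pos (Real.rpow_pos_of_pos hy _) hy).ne' (congrFun hzero ⟨y, hxy⟩)

lemma pos_or_neg_of_mul_pos (h : ∀ x y, (lattice N).Adj x y → 0 < u x * u y) (h0 : u 0 ≠ 0) :
    (∀ x, 0 < u x) ∨ ∀ x, u x < 0 := by
  rcases h0.lt_or_gt with hneg | hpos
  · exact .inr (forall_of_adj (fun x y hxy hx => neg_of_mul_pos_right (h x y hxy) hx.le) hneg)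
  · exact .inl (forall_of_adj (fun x y hxy hx => pos_of_mul_pos_right (h x y hxy) hx.le) hpos)

lemma abs_abs_sub_abs_lt {a b : ℝ} (h : a * b < 0) : |(|b| - |a|)| < |b - a| := by
  have hab : |b| * |a| = -(a * b) := by rw [← abs_mul, mul_comm, abs_of_neg h]
  rw [← sq_lt_sq]
  nlinarith [sq_abs a, sq_abs b]

lemma abs_grad_abs_le (u : (Fin N → ℤ) → ℝ) (c : Cell N) : |grad |u| c| ≤ |grad u c| :=
  abs_grad_comp_le (φ := abs) lipschitzWith_one_norm abs_zero u c

lemma HasFiniteEnergy.abs (hp : 0 ≤ p) (hV : ∀ x, 0 ≤ V x) (hu : HasFiniteEnergy p V u) :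
    HasFiniteEnergy p V |u| := hu.of_le hp hV (abs_grad_abs_le u)

lemma normPow_abs_le (hp : 0 ≤ p) (hV : ∀ x, 0 ≤ V x) (hu : HasFiniteEnergy p V u) :
    normPow p V |u| ≤ normPow p V u :=
  normPow_le_of_density_le hu (hu.abs hp hV) fun c =>
    density_le_density hp hV (abs_grad_abs_le u c)

lemma normPow_abs_lt (hp : 0 < p) (hV : ∀ x, 0 ≤ V x) (hu : HasFiniteEnergy p V u)
    {x y : Fin N → ℤ} (hxy : (lattice N).Adj x y) (h : u x * u y < 0) :
    normPow p V |u| < normPow p V u := by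
  have habs := (hu.abs hp.le hV).summable_density
  rw [normPow_eq_tsum_density hu.summable_density, normPow_eq_tsum_density habs]
  refine habs.tsum_lt_tsum (i := .inl ⟨(x, y), hxy⟩)
    (fun c => density_le_density hp.le hV (abs_grad_abs_le u c)) ?_ hu.summable_density
  exact mul_lt_mul_of_pos_left (Real.rpow_lt_rpow (abs_nonneg _) (abs_abs_sub_abs_lt h) hp)
    one_half_pos

namespace Admissible

lemma energy_abs_add_le (A : Admissible p V f)
    (hF : ∀ x t, primitive f x t ≤ primitive f x |t|) (hu : HasFiniteEnergy p V u) :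
    energy p V f |u| + 1 / p * (normPow p V u - normPow p V |u|) ≤ energy p V f u := by
  have hsum : ∑' x, primitive f x (u x) ≤ ∑' x, primitive f x (|u| x) :=
    (A.summable_primitive hu).tsum_le_tsum (fun x => hF x (u x))
      (A.summable_primitive (hu.abs A.pos.le A.nonneg))
  rw [energy, energy, mul_sub]
  linarith

lemma isGroundState_abs (A : Admissible p V f)
    (hF : ∀ x t, primitive f x t ≤ primitive f x |t|) (hu : IsGroundState p V f u) :
    IsGroundState p V f |u| := by
  obtain ⟨hE, h0, -⟩ := A.mem_nehari.1 hu.1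
  have hle : ∀ w, HasFiniteEnergy p V w → energy p V f |w| ≤ energy p V f w := fun w hw => by
    have hnorm := sub_nonneg.2 (normPow_abs_le A.pos.le A.nonneg hw)
    exact (le_add_of_nonneg_right (mul_nonneg (one_div_pos.2 A.pos).le hnorm)).trans
      (A.energy_abs_add_le hF hw)
  have habs0 : |u| ≠ 0 := fun h => h0 (funext fun x => abs_eq_zero.1 (congrFun h x))
  obtain ⟨t, ht, hmem⟩ := A.exists_smul_mem_nehari (hE.abs A.pos.le A.nonneg) habs0
  have habs : t • |u| = |t • u| := by
    ext x
    simp [abs_mul, abs_of_pos ht]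
  obtain rfl : t = 1 := by
    by_contra ht1
    refine (A.energy_smul_lt hu.1 ht.le ht1).not_ge ((hu.2 _ hmem).trans ?_)
    rw [habs]
    exact hle _ (hE.smul t)
  rw [one_smul] at hmem
  exact ⟨hmem, fun v hv => (hle u hE).trans (hu.2 v hv)⟩

lemma ne_zero_of_isGroundState_of_nonneg (A : Admissible p V f) (hu : IsGroundState p V f u)
    (hu0 : 0 ≤ u) (x : Fin N → ℤ) : u x ≠ 0 := fun hx => by
  refine (A.mem_nehari.1 hu.1).2.1
    (funext (forall_of_adj (P := fun y => u y = 0) (fun y z hyz hy => ?_) hx))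
  have hsol := (A.isSolution_of_isGroundState hu).2 y
  rw [hy, (A.isSuperlinear y).map_zero, mul_zero, add_zero, neg_eq_zero] at hsol
  exact eq_zero_of_pLaplacian_eq_zero hu0 hy hsol hyz

theorem pos_or_neg_of_isGroundState (A : Admissible p V f)
    (hF : ∀ x t, primitive f x t ≤ primitive f x |t|) (hu : IsGroundState p V f u) :
    (∀ x, 0 < u x) ∨ ∀ x, u x < 0 := by
  have hE := (A.mem_nehari.1 hu.1).1
  have habs := A.isGroundState_abs hF hu
  have hne : ∀ x, u x ≠ 0 := fun x =>
    abs_ne_zero.1 (A.ne_zero_of_isGroundState_of_nonneg habs (abs_nonneg u) x)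
  refine pos_or_neg_of_mul_pos (fun x y hxy => ?_) (hne 0)
  by_contra! hxy0
  have hlt := normPow_abs_lt A.pos A.nonneg hE hxy (hxy0.lt_of_ne (mul_ne_zero (hne x) (hne y)))
  have hdiff := mul_pos (one_div_pos.2 A.pos) (sub_pos.2 hlt)
  exact (hu.2 _ habs.1).not_gt
    ((lt_add_of_pos_right _ hdiff).trans_le (A.energy_abs_add_le hF hE))

end Admissible

end Sign

end LatticePLaplace

theorem theorem1p1_general (N : ℕ) (p : ℝ) (hp : 1 < p) (hpN : p < N)
    (T : ℕ) (hT : 0 < T)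
    (V : (Fin N → ℤ) → ℝ) (f : (Fin N → ℤ) → ℝ → ℝ)
    (hVper : LatticePLaplace.IsPeriodic T V) (hfper : LatticePLaplace.IsPeriodic T f)
    (hV : ∀ x, 0 ≤ V x)
    (hfcont : ∀ x, Continuous (f x))
    (hzero : ∀ ε > 0, ∃ δ > 0, ∀ x t, 0 < |t| → |t| < δ →
      |f x t| ≤ ε * |t| ^ (LatticePLaplace.pStar N p - 1))
    (hmono : ∀ x, StrictMonoOn (fun t : ℝ => f x t / |t| ^ (p - 1)) (Set.Iio 0 ∪ Set.Ioi 0))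
    (hsuper : ∀ M : ℝ, ∃ R > 0, ∀ x t, R < |t| →
      M ≤ LatticePLaplace.primitive f x t / |t| ^ p) :
    (∃ u, LatticePLaplace.IsGroundState p V f u) ∧
    (∀ u, LatticePLaplace.IsGroundState p V f u → LatticePLaplace.IsSolution p V f u) ∧
    ((∀ x t, LatticePLaplace.primitive f x t ≤ LatticePLaplace.primitive f x |t|) →
      ∀ u, LatticePLaplace.IsGroundState p V f u → (∀ x, 0 < u x) ∨ (∀ x, u x < 0)) := by
  have A : LatticePLaplace.Admissible p V f :=
    ⟨hp, hpN, hV, hfper.finite_range hT, hfcont, hzero, hmono, hsuper⟩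
  exact ⟨A.exists_isGroundState hT hVper hfper, fun _ => A.isSolution_of_isGroundState,
    fun hF _ => A.pos_or_neg_of_isGroundState hF⟩

theorem theorem1p1 (N : ℕ) (p : ℝ) (hp : 1 < p) (hpN : p < N)
    (T : ℕ) (hT : 0 < T)
    (V : (Fin N → ℤ) → ℝ) (f : (Fin N → ℤ) → ℝ → ℝ)
    -- (S1)
    (hVper : LatticePLaplace.IsPeriodic T V) (hfper : LatticePLaplace.IsPeriodic T f)
    (hV : ∀ x, 0 ≤ V x)
    -- (S2)
    (hfcont : ∀ x, Continuous (f x))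
    (hgrowth : ∃ a > 0, ∃ q > LatticePLaplace.pStar N p,
      ∀ x t, f x t ≤ a * (1 + |t| ^ (q - 1)))
    -- (S3)
    (hzero : ∀ ε > 0, ∃ δ > 0, ∀ x t, 0 < |t| → |t| < δ →
      |f x t| ≤ ε * |t| ^ (LatticePLaplace.pStar N p - 1))
    -- (S4)
    (hmono : ∀ x, StrictMonoOn (fun t : ℝ => f x t / |t| ^ (p - 1)) (Set.Iio 0 ∪ Set.Ioi 0))
    -- (S5)
    (hsuper : ∀ M : ℝ, ∃ R > 0, ∀ x t, R < |t| →
      M ≤ LatticePLaplace.primitive f x t / |t| ^ p) :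
    (∃ u, LatticePLaplace.IsGroundState p V f u) ∧
    (∀ u, LatticePLaplace.IsGroundState p V f u → LatticePLaplace.IsSolution p V f u) ∧
    ((∀ x t, LatticePLaplace.primitive f x t ≤ LatticePLaplace.primitive f x |t|) →
      ∀ u, LatticePLaplace.IsGroundState p V f u → (∀ x, 0 < u x) ∨ (∀ x, u x < 0)) := by
  exact theorem1p1_general N p hp hpN T hT V f hVper hfper hV hfcont hzero hmono hsuper
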